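/- Throughout, graphs are finite and simple. The distance $d_G(e,e')$ between two edges $e,e'$ of a graph $G$ is the distance between the corresponding vertices of the line graph $L(G)$ (and $\infty$ if they lie in different components). For $t,k\in\mathbb{N}$, a \emph{$t$-tone edge $k$-coloring} of $G$ is a map $f$ assigning to each edge of $G$ a $t$-element subset of $\{1,\dots,k\}$ such that $|f(e)\cap f(e')|<d_G(e,e')$ for all distinct edges $e,e'\in E(G)$; the \emph{$t$-tone chromatic index} $\tau'_t(G)$ is the least $k$ for which such a coloring exists. A graph is \emph{subcubic} if its maximum degree is at most $3$, and \emph{outerplanar} if it has a planar embedding in which every vertex lies on the boundary of the outer (unbounded) face. \textbf{Theorem.} Every subcubic outerplanar graph $G$ admits a $2$-tone edge $8$-coloring; that is, $\tau'_2(G)\le 8$. -/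

import Mathlib

namespace ToneEdge

/-- The Euclidean plane. -/
abbrev Plane : Type := EuclideanSpace ℝ (Fin 2)

/-- A `t`-tone edge `k`-coloring of `G`: every edge receives a set of exactly `t` of the `k`
colors, and two distinct edges at distance `d` share fewer than `d` colors. The distance of two
edges is their distance in the line graph; it is `⊤` if they lie in different components. -/
def IsToneEdgeColoring {V : Type*} (G : SimpleGraph V) (t k : ℕ)
    (f : G.edgeSet → Finset (Fin k)) : Prop :=
  (∀ e, (f e).card = t) ∧
    ∀ e e' : G.edgeSet, e ≠ e' → ((f e ∩ f e').card : ℕ∞) < G.lineGraph.edist e e'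

/-- `G` admits a `t`-tone edge `k`-coloring. -/
def ToneEdgeColorable {V : Type*} (G : SimpleGraph V) (t k : ℕ) : Prop :=
  ∃ f : G.edgeSet → Finset (Fin k), IsToneEdgeColoring G t k f

/-- The `t`-tone chromatic index: the least `k` such that `G` admits a `t`-tone edge
`k`-coloring (`⊤` if there is none). -/
noncomputable def toneChromaticIndex {V : Type*} (G : SimpleGraph V) (t : ℕ) : ℕ∞ :=
  ⨅ k ∈ {k : ℕ | ToneEdgeColorable G t k}, (k : ℕ∞)

/-- A planar embedding of `G`: distinct vertices are distinct points of the plane, every edge is a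
simple arc joining its two ends, and the interior of an edge contains no vertex and no point of
the interior of another edge. -/
structure PlanarEmbedding {V : Type*} (G : SimpleGraph V) where
  point : V → Plane
  arc : G.edgeSet → C(unitInterval, Plane)
  point_injective : Function.Injective point
  arc_injective : ∀ e, Function.Injective (arc e)
  arc_ends : ∀ e : G.edgeSet, s(arc e 0, arc e 1) = Sym2.map point (e : Sym2 V)
  arc_ne_point : ∀ (e : G.edgeSet) (x : unitInterval) (v : V),
    x ∈ Set.Ioo 0 1 → arc e x ≠ point v
  arc_ne_arc : ∀ (e e' : G.edgeSet) (x y : unitInterval),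
    e ≠ e' → x ∈ Set.Ioo 0 1 → y ∈ Set.Ioo 0 1 → arc e x ≠ arc e' y

/-- The set of all points of the plane that lie on the embedded graph. -/
def PlanarEmbedding.support {V : Type*} {G : SimpleGraph V} (D : PlanarEmbedding G) :
    Set Plane :=
  Set.range D.point ∪ ⋃ e, Set.range (D.arc e)

/-- A face is a connected component of the complement of the embedded graph. -/
def PlanarEmbedding.IsFace {V : Type*} {G : SimpleGraph V} (D : PlanarEmbedding G)
    (F : Set Plane) : Prop :=
  ∃ x ∈ D.supportᶜ, F = connectedComponentIn D.supportᶜ x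

/-- The outer face is the unbounded face. -/
def PlanarEmbedding.IsOuterFace {V : Type*} {G : SimpleGraph V} (D : PlanarEmbedding G)
    (F : Set Plane) : Prop :=
  D.IsFace F ∧ ¬ Bornology.IsBounded F

/-- A graph is outerplanar if it has a planar embedding in which every vertex lies on the boundary
of the outer face. -/
def IsOuterplanar {V : Type*} (G : SimpleGraph V) : Prop :=
  ∃ (D : PlanarEmbedding G) (F : Set Plane), D.IsOuterFace F ∧ ∀ v, D.point v ∈ frontier F

end ToneEdge

/-! Outerplanarity enters only through two excluded configurations. A point of the outer face can be
joined to every vertex without otherwise meeting the graph. With this apex, two vertices and three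
disjoint connected sets adjacent to both would give a drawing of K₃,₃, and a triangle and a
connected set adjacent to all its vertices would give a drawing of K₅. Neither drawing exists: for
two disjoint curves the argument of the difference of their points has total change zero around the
parameter square, and the integer relations obtained from all pairs of edges without a common end
contradict each other modulo 2.

The rest is combinatorial. In a graph with an edge and without vertices of degree one, take a cycle
`C` and a disjoint connected set `K`, adjacent to `C` unless empty, with `K` as large as possible.
If the graph is subcubic and has no theta minor, maximality forces every vertex of `C` without a
neighbor in `K` to have degree two (`MaxSeparated.eq_or_eq_of_adj`). Two attached vertices that are
not consecutive on `C` yield a theta minor, and an attached triangle is a tetrahedral minor. Hence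
`C` contains two adjacent vertices of degree two, or is a triangle with a vertex of degree two
(`false_of_irreducible`).

These configurations and vertices of degree one are reducible: after deletion of the edges at one
vertex, an 8-coloring extends. Counting forbidden colors and pairs suffices except for the triangle,
which needs the choice in `exists_triangle_pairs`. Induction on the number of edges finishes the
proof. -/

namespace ToneEdge

/-! ### Winding numbers and the nonplanarity of K₅ and K₃,₃ -/

section Winding

open Complex

/-- A nowhere vanishing continuous function on the unit square has a continuous logarithm. -/
theorem exists_continuous_log (h : C(unitInterval × unitInterval, ℂ)) (h0 : ∀ x, h x ≠ 0) :
    ∃ L : C(unitInterval × unitInterval, ℂ), ∀ x, exp (L x) = h x := by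
  -- Clamping both coordinates extends `h` to the simply connected space `ℝ × ℝ`, where maps lift
  -- through the covering `exp`.
  let q : C(ℝ × ℝ, unitInterval × unitInterval) :=
    ⟨fun x => (Set.projIcc 0 1 zero_le_one x.1, Set.projIcc 0 1 zero_le_one x.2), by fun_prop⟩
  obtain ⟨L, ⟨-, hL⟩, -⟩ := isCoveringMapOn_exp.existsUnique_continuousMap_lifts
    (h.comp q) (a₀ := (0, 0)) (exp_log (h0 _)) (fun x => h0 _)
  refine ⟨L.comp ⟨fun x => (x.1, x.2), by fun_prop⟩, fun x => ?_⟩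
  simpa [q] using congrFun hL ((x.1 : ℝ), (x.2 : ℝ))

/-- The difference of two logarithms stays in a discrete fiber of `exp`, so it is constant. This
makes the integers in `exists_winding` independent of the logarithm. -/
theorem sub_eq_sub_of_exp_eq {l l' : unitInterval → ℂ} (hl : Continuous l) (hl' : Continuous l')
    (h : ∀ s, exp (l s) = exp (l' s)) : l 1 - l 0 = l' 1 - l' 0 := by
  have hone : ∀ s, exp (l s - l' s) = 1 := fun s => by
    rw [exp_sub, h s, div_self (exp_ne_zero _)]
  have hconst := isCoveringMap_exp.const_of_comp (hl.sub hl')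
    (fun s t => Subtype.ext ((hone s).trans (hone t).symm)) 1 0
  simp only [Pi.sub_apply] at hconst
  linear_combination hconst

/-- `0` or `1`, depending on whether the pair is increasing. -/
def descent {ι : Type*} [LinearOrder ι] (u w : ι) : ℤ := if u < w then 0 else 1

theorem exp_pi_mul_I_mul_descent {ι : Type*} [LinearOrder ι] (u w : ι) :
    exp (Real.pi * I * descent u w) = if u < w then 1 else -1 := by
  unfold descent
  split_ifs <;> simp

/-- A choice of logarithms of the differences of points such that swapping the two points adds or
subtracts `π * I`. -/
noncomputable def direction {ι : Type*} [LinearOrder ι] (P : ι → ℂ) (u w : ι) : ℂ :=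
  log (P (max u w) - P (min u w)) + Real.pi * I * descent u w

theorem exp_direction {ι : Type*} [LinearOrder ι] {P : ι → ℂ} {u w : ι} (h : P u ≠ P w) :
    exp (direction P u w) = P w - P u := by
  rw [direction, exp_add, exp_pi_mul_I_mul_descent]
  have huw : u ≠ w := fun e => h (e ▸ rfl)
  rcases lt_or_gt_of_ne huw with hlt | hlt
  · rw [max_eq_right hlt.le, min_eq_left hlt.le, exp_log (sub_ne_zero.2 h.symm), if_pos hlt,
      mul_one]
  · rw [max_eq_left hlt.le, min_eq_right hlt.le, exp_log (sub_ne_zero.2 h), if_neg hlt.not_gt]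
    ring

/-- Integers that measure how often the path from `P i` to `P j` winds around `P k`. -/
theorem exists_winding {ι : Type*} [LinearOrder ι] (P : ι → ℂ)
    (γ : ι → ι → C(unitInterval, ℂ)) :
    ∃ n : ι → ι → ι → ℤ, ∀ k i j, γ i j 0 = P i → γ i j 1 = P j →
      ∀ l : unitInterval → ℂ, Continuous l → (∀ s, exp (l s) = γ i j s - P k) →
      l 1 - l 0 = direction P k j - direction P k i + n k i j * (2 * Real.pi * I) := by
  have key : ∀ k i j, ∃ n : ℤ, γ i j 0 = P i → γ i j 1 = P j →
      ∀ l : unitInterval → ℂ, Continuous l → (∀ s, exp (l s) = γ i j s - P k) →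
      l 1 - l 0 = direction P k j - direction P k i + n * (2 * Real.pi * I) := by
    intro k i j
    by_cases hex : (γ i j 0 = P i ∧ γ i j 1 = P j) ∧
      ∃ l : unitInterval → ℂ, Continuous l ∧ ∀ s, exp (l s) = γ i j s - P k
    · obtain ⟨⟨h0, h1⟩, l, hl, hexp⟩ := hex
      have hne : ∀ s, P k ≠ γ i j s := fun s e =>
        exp_ne_zero (l s) (by rw [hexp, e, sub_self])
      have e1 : exp (l 1 - l 0) = exp (direction P k j - direction P k i) := by
        rw [exp_sub, exp_sub, hexp, hexp, h0, h1, exp_direction (h1 ▸ hne 1),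
          exp_direction (h0 ▸ hne 0)]
      obtain ⟨n, hn⟩ := exp_eq_exp_iff_exists_int.1 e1
      refine ⟨n, fun _ _ l' hl' hexp' => ?_⟩
      rw [← hn]
      exact sub_eq_sub_of_exp_eq hl' hl fun s => (hexp' s).trans (hexp s).symm
    -- Without the prescribed ends or a continuous logarithm the claim is vacuous, and `0` is a
    -- default value.
    · refine ⟨0, fun h0 h1 l hl hexp => (hex ⟨⟨h0, h1⟩, l, hl, hexp⟩).elim⟩
  choose n hn using key
  exact ⟨n, hn⟩

/-- Winding numbers of a system of curves in the plane satisfy a linear relation for every two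
disjoint curves. -/
theorem exists_winding_of_joinedIn {ι : Type*} [LinearOrder ι] (P : ι → ℂ)
    (S : ι → ι → Set ℂ) :
    ∃ n : ι → ι → ι → ℤ, ∀ i j k l, JoinedIn (S i j) (P i) (P j) → JoinedIn (S k l) (P k) (P l) →
      Disjoint (S i j) (S k l) →
      descent k j - descent k i + descent j l - descent j k
        - (descent l j - descent l i) - (descent i l - descent i k)
        + 2 * (n k i j + n j k l - n l i j - n i k l) = 0 := by
  classical
  let γ : ι → ι → C(unitInterval, ℂ) := fun i j =>
    if h : JoinedIn (S i j) (P i) (P j) then h.somePath else 0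
  obtain ⟨n, hn⟩ := exists_winding P γ
  refine ⟨n, fun i j k l hij hkl hdis => ?_⟩
  have hi : γ i j 0 = P i := by simp [γ, hij]
  have hj : γ i j 1 = P j := by simp [γ, hij]
  have hk : γ k l 0 = P k := by simp [γ, hkl]
  have hl : γ k l 1 = P l := by simp [γ, hkl]
  have hne : ∀ s t, γ i j s ≠ γ k l t := fun s t e => by
    have h1 : γ i j s ∈ S i j := by simp [γ, hij]
    have h2 : γ k l t ∈ S k l := by simp [γ, hkl]
    exact Set.disjoint_left.1 hdis h1 (e ▸ h2)
  obtain ⟨L, hL⟩ := exists_continuous_log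
    ⟨fun x : unitInterval × unitInterval => γ i j x.1 - γ k l x.2, by fun_prop⟩
    fun x => sub_ne_zero.2 (hne _ _)
  simp only [ContinuousMap.coe_mk] at hL
  -- The four sides of the square: on each, one of the two points rests at its end. On the sides
  -- where the first point rests, the difference has the opposite sign, hence the shift by `π * I`.
  have e1 := hn k i j hi hj (fun s => L (s, 0)) (by fun_prop)
    fun s => by rw [hL, hk]
  have e2 := hn l i j hi hj (fun s => L (s, 1)) (by fun_prop)
    fun s => by rw [hL, hl]
  have e3 := hn j k l hk hl (fun s => L (1, s) + Real.pi * I) (by fun_prop)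
    fun s => by rw [exp_add, hL, hj, exp_pi_mul_I]; ring
  have e4 := hn i k l hk hl (fun s => L (0, s) + Real.pi * I) (by fun_prop)
    fun s => by rw [exp_add, hL, hi, exp_pi_mul_I]; ring
  simp only [direction] at e1 e2 e3 e4
  -- The logarithms in `direction` are symmetric in the two points and cancel around the square;
  -- only the integer parts remain.
  rw [max_comm k j, max_comm k i, min_comm k j, min_comm k i] at e1
  rw [max_comm l j, max_comm l i, min_comm l j, min_comm l i] at e2
  have hpi : (Real.pi * I : ℂ) ≠ 0 := by simp [Real.pi_ne_zero]
  have := mul_left_cancel₀ hpi (b := ((descent k j - descent k i + descent j l - descent j k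
      - (descent l j - descent l i) - (descent i l - descent i k)
      + 2 * (n k i j + n j k l - n l i j - n i k l) : ℤ) : ℂ)) (c := 0) (by
    push_cast
    linear_combination e2 + e4 - e1 - e3)
  exact_mod_cast this

/-- The graph `K₅` cannot be drawn in the complex plane such that edges without a common end are
disjoint. Here `R`, `M`, `N` and `Z` contain the edges of a triangle, the edges from the triangle
to the fourth and to the fifth vertex, and the edge between these two vertices. -/
theorem false_of_K5_drawing_complex {c : Fin 3 → ℂ} {t o : ℂ} {R M N : Fin 3 → Set ℂ} {Z : Set ℂ}
    (hR : ∀ i j k, i ≠ j → i ≠ k → j ≠ k → JoinedIn (R k) (c i) (c j))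
    (hM : ∀ i, JoinedIn (M i) (c i) t) (hN : ∀ i, JoinedIn (N i) (c i) o) (hZ : JoinedIn Z t o)
    (hRM : ∀ i, Disjoint (R i) (M i)) (hRN : ∀ i, Disjoint (R i) (N i))
    (hRZ : ∀ i, Disjoint (R i) Z) (hMN : ∀ i j, i ≠ j → Disjoint (M i) (N j)) : False := by
  obtain ⟨n, r⟩ := exists_winding_of_joinedIn ![c 0, c 1, c 2, t, o]
    ![![∅, R 2, R 1, M 0, N 0], ![∅, ∅, R 0, M 1, N 1], ![∅, ∅, ∅, M 2, N 2], ![∅, ∅, ∅, ∅, Z],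
      ![∅, ∅, ∅, ∅, ∅]]
  have R01 := hR 0 1 2 (by decide) (by decide) (by decide)
  have R02 := hR 0 2 1 (by decide) (by decide) (by decide)
  have R12 := hR 1 2 0 (by decide) (by decide) (by decide)
  have e1 := r 0 1 2 3 R01 (hM 2) (hRM 2)
  have e2 := r 0 2 1 3 R02 (hM 1) (hRM 1)
  have e3 := r 0 3 1 2 (hM 0) R12 (hRM 0).symm
  have e4 := r 0 1 2 4 R01 (hN 2) (hRN 2)
  have e5 := r 0 2 1 4 R02 (hN 1) (hRN 1)
  have e6 := r 0 4 1 2 (hN 0) R12 (hRN 0).symm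
  have e7 := r 0 1 3 4 R01 hZ (hRZ 2)
  have e8 := r 0 3 1 4 (hM 0) (hN 1) (hMN 0 1 (by decide))
  have e9 := r 0 4 1 3 (hN 0) (hM 1) (hMN 1 0 (by decide)).symm
  have e10 := r 0 2 3 4 R02 hZ (hRZ 1)
  have e11 := r 0 3 2 4 (hM 0) (hN 2) (hMN 0 2 (by decide))
  have e12 := r 0 4 2 3 (hN 0) (hM 2) (hMN 2 0 (by decide)).symm
  have e13 := r 1 2 3 4 R12 hZ (hRZ 0)
  have e14 := r 1 3 2 4 (hM 1) (hN 2) (hMN 1 2 (by decide))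
  have e15 := r 1 4 2 3 (hN 1) (hM 2) (hMN 2 1 (by decide)).symm
  -- The descent part of a relation is `-2` if the ends of the two edges interleave in the order of
  -- the labels, and `0` otherwise. Each four labels give one interleaving pair, so there are five.
  -- Each `n k i j` that occurs does so in two relations, one for each edge at `k` avoiding `i` and
  -- `j`. The sum of the halved relations is therefore odd, a contradiction.
  simp [descent] at e1 e2 e3 e4 e5 e6 e7 e8 e9 e10 e11 e12 e13 e14 e15
  omega

/-- The graph `K₃,₃` cannot be drawn in the complex plane such that edges without a common end are
disjoint. -/
theorem false_of_K33_drawing_complex {a b o : ℂ} {x : Fin 3 → ℂ} {A B C : Fin 3 → Set ℂ}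
    (hA : ∀ i, JoinedIn (A i) a (x i)) (hB : ∀ i, JoinedIn (B i) b (x i))
    (hC : ∀ i, JoinedIn (C i) o (x i)) (hAB : ∀ i j, i ≠ j → Disjoint (A i) (B j))
    (hAC : ∀ i j, i ≠ j → Disjoint (A i) (C j)) (hBC : ∀ i j, i ≠ j → Disjoint (B i) (C j)) :
    False := by
  obtain ⟨n, r⟩ := exists_winding_of_joinedIn ![a, b, o, x 0, x 1, x 2]
    ![![∅, ∅, ∅, A 0, A 1, A 2], ![∅, ∅, ∅, B 0, B 1, B 2], ![∅, ∅, ∅, C 0, C 1, C 2],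
      fun _ => ∅, fun _ => ∅, fun _ => ∅]
  have e1 := r 0 3 1 4 (hA 0) (hB 1) (hAB 0 1 (by decide))
  have e2 := r 0 3 1 5 (hA 0) (hB 2) (hAB 0 2 (by decide))
  have e3 := r 0 3 2 4 (hA 0) (hC 1) (hAC 0 1 (by decide))
  have e4 := r 0 3 2 5 (hA 0) (hC 2) (hAC 0 2 (by decide))
  have e5 := r 0 4 1 3 (hA 1) (hB 0) (hAB 1 0 (by decide))
  have e6 := r 0 4 1 5 (hA 1) (hB 2) (hAB 1 2 (by decide))
  have e7 := r 0 4 2 3 (hA 1) (hC 0) (hAC 1 0 (by decide))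
  have e8 := r 0 4 2 5 (hA 1) (hC 2) (hAC 1 2 (by decide))
  have e9 := r 0 5 1 3 (hA 2) (hB 0) (hAB 2 0 (by decide))
  have e10 := r 0 5 1 4 (hA 2) (hB 1) (hAB 2 1 (by decide))
  have e11 := r 0 5 2 3 (hA 2) (hC 0) (hAC 2 0 (by decide))
  have e12 := r 0 5 2 4 (hA 2) (hC 1) (hAC 2 1 (by decide))
  have e13 := r 1 3 2 4 (hB 0) (hC 1) (hBC 0 1 (by decide))
  have e14 := r 1 3 2 5 (hB 0) (hC 2) (hBC 0 2 (by decide))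
  have e15 := r 1 4 2 3 (hB 1) (hC 0) (hBC 1 0 (by decide))
  have e16 := r 1 4 2 5 (hB 1) (hC 2) (hBC 1 2 (by decide))
  have e17 := r 1 5 2 3 (hB 2) (hC 0) (hBC 2 0 (by decide))
  have e18 := r 1 5 2 4 (hB 2) (hC 1) (hBC 2 1 (by decide))
  -- The same parity argument: nine of the eighteen pairs interleave, and each winding number that
  -- occurs does so twice.
  simp [descent] at e1 e2 e3 e4 e5 e6 e7 e8 e9 e10 e11 e12 e13 e14 e15 e16 e17 e18
  omega

end Winding

/-! ### Excluded minors of outerplanar graphs -/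

section Minors

/-- An identification of the Euclidean plane with the complex plane. -/
noncomputable def planeEquiv : Plane ≃ₗᵢ[ℝ] ℂ := Complex.orthonormalBasisOneI.repr.symm

/-- The graph `K₅` cannot be drawn in the plane such that edges without a common end are
disjoint. -/
theorem false_of_K5_drawing {c : Fin 3 → Plane} {t o : Plane} {R M N : Fin 3 → Set Plane}
    {Z : Set Plane} (hR : ∀ i j k, i ≠ j → i ≠ k → j ≠ k → JoinedIn (R k) (c i) (c j))
    (hM : ∀ i, JoinedIn (M i) (c i) t) (hN : ∀ i, JoinedIn (N i) (c i) o) (hZ : JoinedIn Z t o)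
    (hRM : ∀ i, Disjoint (R i) (M i)) (hRN : ∀ i, Disjoint (R i) (N i))
    (hRZ : ∀ i, Disjoint (R i) Z) (hMN : ∀ i j, i ≠ j → Disjoint (M i) (N j)) : False := by
  have hc := planeEquiv.continuous
  have hd : ∀ {s t : Set Plane}, Disjoint s t → Disjoint (planeEquiv '' s) (planeEquiv '' t) :=
    fun h => (Set.disjoint_image_iff planeEquiv.injective).2 h
  exact false_of_K5_drawing_complex (c := fun i => planeEquiv (c i))
    (R := fun i => planeEquiv '' R i) (M := fun i => planeEquiv '' M i)
    (N := fun i => planeEquiv '' N i)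
    (fun i j k h h' h'' => (hR i j k h h' h'').map hc) (fun i => (hM i).map hc)
    (fun i => (hN i).map hc) (hZ.map hc) (fun i => hd (hRM i)) (fun i => hd (hRN i))
    (fun i => hd (hRZ i)) (fun i j h => hd (hMN i j h))

/-- The graph `K₃,₃` cannot be drawn in the plane such that edges without a common end are
disjoint. -/
theorem false_of_K33_drawing {a b o : Plane} {x : Fin 3 → Plane} {A B C : Fin 3 → Set Plane}
    (hA : ∀ i, JoinedIn (A i) a (x i)) (hB : ∀ i, JoinedIn (B i) b (x i))
    (hC : ∀ i, JoinedIn (C i) o (x i)) (hAB : ∀ i j, i ≠ j → Disjoint (A i) (B j))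
    (hAC : ∀ i j, i ≠ j → Disjoint (A i) (C j)) (hBC : ∀ i j, i ≠ j → Disjoint (B i) (C j)) :
    False := by
  have hc := planeEquiv.continuous
  have hd : ∀ {s t : Set Plane}, Disjoint s t → Disjoint (planeEquiv '' s) (planeEquiv '' t) :=
    fun h => (Set.disjoint_image_iff planeEquiv.injective).2 h
  exact false_of_K33_drawing_complex (x := fun i => planeEquiv (x i))
    (A := fun i => planeEquiv '' A i) (B := fun i => planeEquiv '' B i)
    (C := fun i => planeEquiv '' C i)
    (fun i => (hA i).map hc) (fun i => (hB i).map hc) (fun i => (hC i).map hc)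
    (fun i j h => hd (hAB i j h)) (fun i j h => hd (hAC i j h)) (fun i j h => hd (hBC i j h))

variable {V : Type*} {G : SimpleGraph V}

/-- There is a walk from `u` to `v` inside `S`. -/
def LinkedIn (G : SimpleGraph V) (S : Set V) (u v : V) : Prop :=
  ∃ w : G.Walk u v, ∀ x ∈ w.support, x ∈ S

/-- Every two vertices of `S` are joined by a walk inside `S`. -/
def ConnectedSet (G : SimpleGraph V) (S : Set V) : Prop :=
  ∀ u ∈ S, ∀ v ∈ S, LinkedIn G S u v

theorem LinkedIn.refl {S : Set V} {u : V} (h : u ∈ S) : LinkedIn G S u u :=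
  ⟨.nil, by simpa using h⟩

theorem LinkedIn.symm {S : Set V} {u v : V} (h : LinkedIn G S u v) : LinkedIn G S v u := by
  obtain ⟨w, hw⟩ := h
  exact ⟨w.reverse, by simpa using hw⟩

theorem LinkedIn.trans {S : Set V} {u v w : V} (h : LinkedIn G S u v) (h' : LinkedIn G S v w) :
    LinkedIn G S u w := by
  obtain ⟨p, hp⟩ := h
  obtain ⟨q, hq⟩ := h'
  refine ⟨p.append q, fun x hx => ?_⟩
  rcases (SimpleGraph.Walk.mem_support_append_iff _ _).1 hx with h | h
  exacts [hp x h, hq x h]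

theorem LinkedIn.mono {S T : Set V} {u v : V} (h : LinkedIn G S u v) (hST : S ⊆ T) :
    LinkedIn G T u v := by
  obtain ⟨w, hw⟩ := h
  exact ⟨w, fun x hx => hST (hw x hx)⟩

theorem LinkedIn.mono_graph {H : SimpleGraph V} {S : Set V} {u v : V} (h : LinkedIn G S u v)
    (hGH : G ≤ H) : LinkedIn H S u v := by
  obtain ⟨w, hw⟩ := h
  exact ⟨w.mapLe hGH, by simpa using hw⟩

theorem LinkedIn.of_adj {S : Set V} {u v : V} (h : G.Adj u v) (hu : u ∈ S) (hv : v ∈ S) :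
    LinkedIn G S u v :=
  ⟨h.toWalk, by simp [hu, hv]⟩

theorem ConnectedSet.mono_graph {H : SimpleGraph V} {S : Set V} (h : ConnectedSet G S)
    (hGH : G ≤ H) : ConnectedSet H S :=
  fun u hu v hv => (h u hu v hv).mono_graph hGH

/-- A vertex adjacent to a connected set is linked to all vertices of that set. -/
theorem ConnectedSet.linkedIn_insert {S : Set V} (h : ConnectedSet G S) {a x y : V} (hx : x ∈ S)
    (hax : G.Adj a x) (hy : y ∈ S) : LinkedIn G (insert a S) a y :=
  (LinkedIn.of_adj hax (Set.mem_insert _ _) (Set.mem_insert_of_mem _ hx)).trans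
    ((h x hx y hy).mono (Set.subset_insert _ _))

theorem ConnectedSet.union {S T : Set V} (hS : ConnectedSet G S) (hT : ConnectedSet G T)
    {x y : V} (hx : x ∈ S) (hy : y ∈ T) (hxy : G.Adj x y) : ConnectedSet G (S ∪ T) := by
  have hlink : LinkedIn G (S ∪ T) x y := .of_adj hxy (.inl hx) (.inr hy)
  have h1 : ∀ u ∈ S ∪ T, LinkedIn G (S ∪ T) u x := by
    rintro u (hu | hu)
    · exact (hS u hu x hx).mono Set.subset_union_left
    · exact ((hT u hu y hy).mono Set.subset_union_right).trans hlink.symm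
  exact fun u hu v hv => (h1 u hu).trans (h1 v hv).symm

/-- Two vertices and three disjoint connected sets, each adjacent to both vertices. -/
def HasThetaMinor (G : SimpleGraph V) : Prop :=
  ∃ (a b : V) (S : Fin 3 → Set V), a ≠ b ∧ (∀ i, ConnectedSet G (S i)) ∧
    (∀ i j, i ≠ j → Disjoint (S i) (S j)) ∧
    ∀ i, a ∉ S i ∧ b ∉ S i ∧ (∃ x ∈ S i, G.Adj a x) ∧ ∃ x ∈ S i, G.Adj b x

/-- A triangle and a connected set disjoint from it that is adjacent to all its vertices. -/
def HasTetrahedralMinor (G : SimpleGraph V) : Prop :=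
  ∃ (c : Fin 3 → V) (K : Set V), (∀ i j, i ≠ j → G.Adj (c i) (c j)) ∧ ConnectedSet G K ∧
    ∀ i, c i ∉ K ∧ ∃ x ∈ K, G.Adj (c i) x

theorem HasThetaMinor.mono {H : SimpleGraph V} (hGH : G ≤ H) (h : HasThetaMinor G) :
    HasThetaMinor H := by
  obtain ⟨a, b, S, hab, hS, hdis, hadj⟩ := h
  refine ⟨a, b, S, hab, fun i => (hS i).mono_graph hGH, hdis, fun i => ?_⟩
  obtain ⟨h1, h2, ⟨x, hx, hax⟩, ⟨y, hy, hby⟩⟩ := hadj i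
  exact ⟨h1, h2, ⟨x, hx, hGH hax⟩, ⟨y, hy, hGH hby⟩⟩

theorem HasTetrahedralMinor.mono {H : SimpleGraph V} (hGH : G ≤ H) (h : HasTetrahedralMinor G) :
    HasTetrahedralMinor H := by
  obtain ⟨c, K, hc, hK, hadj⟩ := h
  refine ⟨c, K, fun i j hij => hGH (hc i j hij), hK.mono_graph hGH, fun i => ?_⟩
  obtain ⟨h1, x, hx, h⟩ := hadj i
  exact ⟨h1, x, hx, hGH h⟩

namespace PlanarEmbedding

variable (D : PlanarEmbedding G)

/-- The part of the plane covered by the subgraph induced on `S`. -/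
def region (S : Set V) : Set Plane :=
  D.point '' S ∪ ⋃ e ∈ {e : G.edgeSet | ∀ v ∈ (e : Sym2 V), v ∈ S}, Set.range (D.arc e)

theorem region_mono {S T : Set V} (h : S ⊆ T) : D.region S ⊆ D.region T := by
  refine Set.union_subset_union (Set.image_mono h) ?_
  exact Set.biUnion_subset_biUnion_left fun e he v hv => h (he v hv)

theorem region_subset_support (S : Set V) : D.region S ⊆ D.support := by
  refine Set.union_subset_union (Set.image_subset_range _ _) ?_
  exact Set.iUnion_mono fun e => Set.iUnion_subset fun _ => subset_rfl

theorem mem_region {S : Set V} {y : Plane} (hy : y ∈ D.region S) :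
    (∃ v ∈ S, D.point v = y) ∨ ∃ e : G.edgeSet, (∀ v ∈ (e : Sym2 V), v ∈ S) ∧
      ∃ t ∈ Set.Ioo (0 : unitInterval) 1, D.arc e t = y := by
  rcases hy with hy | hy
  · exact .inl hy
  · simp only [Set.mem_ofPred_eq, Set.mem_iUnion, Set.mem_range] at hy
    obtain ⟨e, he, t, rfl⟩ := hy
    have hends : ∀ p ∈ s(D.arc e 0, D.arc e 1), ∃ v ∈ S, D.point v = p := by
      intro p hp
      rw [D.arc_ends e, Sym2.mem_map] at hp
      obtain ⟨v, hv, h⟩ := hp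
      exact ⟨v, he v hv, h⟩
    rcases eq_or_ne t 0 with rfl | h0
    · exact .inl (hends _ (Sym2.mem_mk_left _ _))
    rcases eq_or_ne t 1 with rfl | h1
    · exact .inl (hends _ (Sym2.mem_mk_right _ _))
    · exact .inr ⟨e, he, t, ⟨unitInterval.pos_iff_ne_zero.2 h0, unitInterval.lt_one_iff_ne_one.2 h1⟩,
        rfl⟩

/-- By `mem_region`, a common point is, for each side, a vertex or an interior point of an arc. The
axioms of an embedding then force a common vertex or a common edge, and the ends of a common edge
lie in both sets. -/
theorem disjoint_region {S T : Set V} (h : Disjoint S T) : Disjoint (D.region S) (D.region T) := by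
  refine Set.disjoint_left.2 fun y hyS hyT => ?_
  rcases D.mem_region hyS with ⟨v, hv, rfl⟩ | ⟨e, he, t, ht, rfl⟩ <;>
    rcases D.mem_region hyT with ⟨v', hv', h'⟩ | ⟨e', he', t', ht', h'⟩
  · exact Set.disjoint_left.1 h hv (D.point_injective h' ▸ hv')
  · exact D.arc_ne_point e' t' v ht' h'
  · exact D.arc_ne_point e t v' ht h'.symm
  · refine D.arc_ne_arc e e' t t' ?_ ht ht' h'.symm
    rintro rfl
    obtain ⟨⟨v, w⟩, hvw⟩ := e
    exact Set.disjoint_left.1 h (he v (Sym2.mem_mk_left _ _)) (he' v (Sym2.mem_mk_left _ _))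

theorem joinedIn_region_of_adj {S : Set V} {u v : V} (h : G.Adj u v) (hu : u ∈ S) (hv : v ∈ S) :
    JoinedIn (D.region S) (D.point u) (D.point v) := by
  have hsub : Set.range (D.arc ⟨s(u, v), h⟩) ⊆ D.region S := by
    refine Set.subset_union_of_subset_right (Set.subset_biUnion_of_mem
      (u := fun e => Set.range (D.arc e)) ?_) _
    simp [hu, hv]
  have hj : JoinedIn (D.region S) (D.arc ⟨s(u, v), h⟩ 0) (D.arc ⟨s(u, v), h⟩ 1) :=
    ⟨⟨D.arc ⟨s(u, v), h⟩, rfl, rfl⟩, fun t => hsub ⟨t, rfl⟩⟩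
  have hends := D.arc_ends ⟨s(u, v), h⟩
  simp only [Sym2.map_mk, Sym2.eq_iff] at hends
  rcases hends with ⟨h0, h1⟩ | ⟨h0, h1⟩
  · rwa [h0, h1] at hj
  · rw [h0, h1] at hj
    exact hj.symm

theorem joinedIn_region {S : Set V} {u v : V} (h : LinkedIn G S u v) :
    JoinedIn (D.region S) (D.point u) (D.point v) := by
  obtain ⟨w, hw⟩ := h
  induction w with
  | nil => exact .refl (.inl ⟨_, hw _ (by simp), rfl⟩)
  | cons h p ih =>
    refine (D.joinedIn_region_of_adj h (hw _ (by simp)) (hw _ (by simp))).trans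
      (ih fun x hx => hw x (by simp [hx]))

theorem isClosed_region [Finite V] (S : Set V) : IsClosed (D.region S) := by
  refine IsClosed.union (S.toFinite.image _).isClosed ?_
  exact (Set.toFinite _).isClosed_biUnion fun e _ =>
    (isCompact_range (D.arc e).continuous).isClosed

theorem region_univ : D.region Set.univ = D.support := by
  simp [region, support]

/-- If all vertices lie on the boundary of a face, then a point in this face can be joined to
every vertex such that the curve to `v` avoids the graph apart from `v` and its edges. -/
theorem exists_apex [Finite V] {F : Set Plane} (hF : D.IsFace F)
    (hfr : ∀ v, D.point v ∈ frontier F) :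
    ∃ (o : Plane) (B : V → Set Plane), (∀ v, JoinedIn (B v) o (D.point v)) ∧
      ∀ v T, v ∉ T → Disjoint (B v) (D.region T) := by
  obtain ⟨o, ho, rfl⟩ := hF
  have hopen : IsOpen D.supportᶜ := (D.region_univ ▸ D.isClosed_region Set.univ).isOpen_compl
  set F := connectedComponentIn D.supportᶜ o with hFdef
  have hFo : IsOpen F := hopen.connectedComponentIn
  have hpc : IsPathConnected F := hFo.isConnected_iff_isPathConnected.1
    (isConnected_connectedComponentIn_iff.2 ho)
  have hoF : o ∈ F := mem_connectedComponentIn ho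
  -- The subgraph induced on the other vertices covers a closed set that misses the point of `v`, so
  -- a small disc around this point avoids it. The disc meets the face because the point lies on its
  -- frontier.
  have hball : ∀ v, ∃ r > 0, Metric.ball (D.point v) r ⊆ (D.region {v}ᶜ)ᶜ := by
    intro v
    refine Metric.isOpen_iff.1 (D.isClosed_region {v}ᶜ).isOpen_compl _ fun hv => ?_
    refine Set.disjoint_left.1 (D.disjoint_region (disjoint_compl_right (a := {v}))) ?_ hv
    exact .inl ⟨v, rfl, rfl⟩
  choose r hr hrsub using hball
  -- The sets for different vertices overlap in `F`. This is harmless, since the apex edges share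
  -- the end `o`.
  refine ⟨o, fun v => F ∪ Metric.ball (D.point v) (r v), fun v => ?_, fun v T hvT => ?_⟩
  · obtain ⟨q, hqF, hq⟩ := Metric.mem_closure_iff.1 (frontier_subset_closure (hfr v)) (r v) (hr v)
    refine ((hpc.joinedIn o hoF q hqF).mono Set.subset_union_left).trans ?_
    refine JoinedIn.mono ?_ Set.subset_union_right
    exact ((convex_ball _ _).isPathConnected ⟨_, Metric.mem_ball_self (hr v)⟩).joinedIn q
      (by rwa [Metric.mem_ball, dist_comm]) _ (Metric.mem_ball_self (hr v))
  · refine Set.disjoint_union_left.2 ⟨?_, ?_⟩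
    · exact Set.disjoint_left.2 fun y hy hyT =>
        connectedComponentIn_subset _ _ hy (D.region_subset_support _ hyT)
    · exact Set.disjoint_left.2 fun y hy hyT =>
        hrsub v hy (D.region_mono (fun x hx (e : x = v) => hvT (e ▸ hx)) hyT)

end PlanarEmbedding

/-- In the resulting K₃,₃, the vertices `a`, `b` and the apex face one vertex `x i` of each `S i`.
The edges from `a` and `b` to `x i` may both run through `S i`, because only edges without a common
end have to be disjoint. -/
theorem IsOuterplanar.not_hasThetaMinor [Finite V] (h : IsOuterplanar G) :
    ¬ HasThetaMinor G := by
  obtain ⟨D, F, hF, hfr⟩ := h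
  obtain ⟨o, B, hB, hdisB⟩ := D.exists_apex hF.1 hfr
  rintro ⟨a, b, S, hab, hS, hdis, hadj⟩
  choose ha hb hax hbx using hadj
  choose x hx hax using hax
  choose y hy hby using hbx
  refine false_of_K33_drawing (x := fun i => D.point (x i))
    (A := fun i => D.region (insert a (S i))) (B := fun i => D.region (insert b (S i)))
    (C := fun i => B (x i))
    (fun i => D.joinedIn_region ((hS i).linkedIn_insert (hx i) (hax i) (hx i)))
    (fun i => D.joinedIn_region ((hS i).linkedIn_insert (hy i) (hby i) (hx i)))
    (fun i => hB _) (fun i j hij => D.disjoint_region ?_)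
    (fun i j hij => (hdisB _ _ ?_).symm) (fun i j hij => (hdisB _ _ ?_).symm)
  · simp [Set.disjoint_insert_left, Set.disjoint_insert_right, ha, hb, hab.symm, hdis i j hij]
  · rintro (h | h)
    exacts [ha j (h ▸ hx j), Set.disjoint_left.1 (hdis i j hij) h (hx j)]
  · rintro (h | h)
    exacts [hb j (h ▸ hx j), Set.disjoint_left.1 (hdis i j hij) h (hx j)]

/-- The triangle, the vertex `x 0` of `K` and the apex form a K₅; all edges from the triangle to `x
0` run through `K`. -/
theorem IsOuterplanar.not_hasTetrahedralMinor [Finite V] (h : IsOuterplanar G) :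
    ¬ HasTetrahedralMinor G := by
  obtain ⟨D, F, hF, hfr⟩ := h
  obtain ⟨o, B, hB, hdisB⟩ := D.exists_apex hF.1 hfr
  rintro ⟨c, K, hc, hK, hadj⟩
  choose hcK x hx hcx using hadj
  have hinj : ∀ i j, i ≠ j → c i ≠ c j := fun i j hij => (hc i j hij).ne
  refine false_of_K5_drawing (c := fun i => D.point (c i)) (t := D.point (x 0)) (o := o)
    (R := fun k => D.region {v | ∃ i, i ≠ k ∧ c i = v})
    (M := fun i => D.region (insert (c i) K)) (N := fun i => B (c i)) (Z := B (x 0))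
    (fun i j k hij hik hjk => D.joinedIn_region
      (.of_adj (hc i j hij) ⟨i, hik, rfl⟩ ⟨j, hjk, rfl⟩))
    (fun i => D.joinedIn_region (hK.linkedIn_insert (hx i) (hcx i) (hx 0)))
    (fun i => (hB _).symm) (hB _).symm (fun i => D.disjoint_region ?_)
    (fun i => (hdisB _ _ ?_).symm) (fun i => (hdisB _ _ ?_).symm)
    (fun i j hij => (hdisB _ _ ?_).symm)
  · refine Set.disjoint_left.2 ?_
    rintro _ ⟨j, hj, rfl⟩ (h | h)
    exacts [hinj j i hj h, hcK j h]
  · rintro ⟨j, hj, h⟩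
    exact hinj j i hj h
  · rintro ⟨j, hj, h⟩
    exact hcK j (h ▸ hx 0)
  · rintro (h | h)
    exacts [hinj i j hij h.symm, hcK j h]

end Minors

/-! ### Pair colorings and their extension -/

section Coloring

variable {V : Type*} {G : SimpleGraph V}

/-- A coloring of the edges in `S` with pairs of colors such that incident edges get disjoint
pairs and edges joined by an edge of `G` get different pairs. -/
structure IsPairColoring (G : SimpleGraph V) (S : Set (Sym2 V)) (f : Sym2 V → Finset (Fin 8)) :
    Prop where
  card : ∀ e ∈ S, (f e).card = 2
  disjoint : ∀ p q r, s(p, q) ∈ S → s(q, r) ∈ S → p ≠ r → Disjoint (f s(p, q)) (f s(q, r))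
  ne : ∀ p q r t, s(p, q) ∈ S → G.Adj q r → s(r, t) ∈ S → p ≠ r → q ≠ t → p ≠ t →
    f s(p, q) ≠ f s(r, t)

theorem IsPairColoring.toneEdgeColorable {f : Sym2 V → Finset (Fin 8)}
    (hf : IsPairColoring G G.edgeSet f) : ToneEdgeColorable G 2 8 := by
  refine ⟨fun e => f e, fun e => hf.card e e.2, fun e e' hne => ?_⟩
  have hadj : ∀ {e e' : G.edgeSet}, G.lineGraph.Adj e e' →
      ∃ p q r, (e : Sym2 V) = s(p, q) ∧ (e' : Sym2 V) = s(q, r) ∧ p ≠ r := by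
    rintro ⟨e, he⟩ ⟨e', he'⟩ h
    obtain ⟨hne, q, hq, hq'⟩ := SimpleGraph.lineGraph_adj_iff_exists.1 h
    obtain ⟨p, rfl⟩ := Sym2.mem_iff_exists.1 hq
    obtain ⟨r, rfl⟩ := Sym2.mem_iff_exists.1 hq'
    refine ⟨p, q, r, Sym2.eq_swap, rfl, ?_⟩
    rintro rfl
    exact hne rfl
  have hdis : ∀ {e e' : G.edgeSet}, G.lineGraph.Adj e e' → Disjoint (f e) (f e') := by
    intro e e' h
    obtain ⟨p, q, r, he, he', hpr⟩ := hadj h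
    have h1 := e.2
    have h2 := e'.2
    rw [he] at h1 ⊢
    rw [he'] at h2 ⊢
    exact hf.disjoint p q r h1 h2 hpr
  by_cases htop : G.lineGraph.edist e e' = ⊤
  · rw [htop]; exact ENat.natCast_lt_top _
  obtain ⟨w, hw⟩ := SimpleGraph.exists_walk_of_edist_ne_top htop
  rw [← hw]
  norm_cast
  -- Distance one demands disjoint pairs and distance two different pairs; from distance three on,
  -- nothing is demanded, as two pairs share at most two colors.
  rcases w with _ | ⟨h, _ | @⟨_, g, _, h', _ | ⟨h'', w⟩⟩⟩
  · exact (hne rfl).elim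
  · simp [Finset.disjoint_iff_inter_eq_empty.1 (hdis h)]
  · rename_i g
    simp only [SimpleGraph.Walk.length_cons, SimpleGraph.Walk.length_nil]
    by_contra! hcon
    have heq : f e = f e' := by
      have h1 : f e ∩ f e' = f e :=
        Finset.eq_of_subset_of_card_le Finset.inter_subset_left (by rw [hf.card e e.2]; omega)
      have h2 : f e ∩ f e' = f e' :=
        Finset.eq_of_subset_of_card_le Finset.inter_subset_right (by rw [hf.card e' e'.2]; omega)
      rw [← h1, h2]
    have hnot : ¬ Disjoint (f e) (f e') := by
      rw [heq, disjoint_self, Finset.bot_eq_empty, ← Finset.card_eq_zero, hf.card e' e'.2]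
      simp
    have h1 := e.2
    have h2 := e'.2
    obtain ⟨p, q, r, he, hg, hpr⟩ := hadj h
    obtain ⟨p', q', r', hg', he', hpr'⟩ := hadj h'
    have hg2 := g.2
    rw [he] at h1 heq hnot
    rw [he'] at h2 heq hnot
    rw [hg] at hg' hg2
    rcases Sym2.eq_iff.1 hg' with ⟨rfl, rfl⟩ | ⟨rfl, rfl⟩
    · rcases eq_or_ne q r' with rfl | hqt
      · exact hpr' rfl
      -- If the outer ends coincide, the three edges form a triangle and the outer two are incident.
      · rcases eq_or_ne p r' with rfl | hpt
        · rw [Sym2.eq_swap] at h1 h2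
          have hqr := hf.disjoint q p r h1 h2 (SimpleGraph.Adj.ne hg2)
          exact hnot (by rwa [Sym2.eq_swap (a := p), Sym2.eq_swap (a := r)])
        · exact hf.ne p q r r' h1 hg2 h2 hpr hqt hpt heq
    · rcases eq_or_ne p r' with rfl | hpt
      · exact hne (Subtype.ext (by rw [he, he', Sym2.eq_swap]))
      · exact hnot (hf.disjoint p q r' h1 h2 hpt)
  · simp only [SimpleGraph.Walk.length_cons]
    have := Finset.card_le_card (Finset.inter_subset_left (s₁ := f e) (s₂ := f e'))
    rw [hf.card e e.2] at this
    omega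

theorem toneChromaticIndex_le {t k : ℕ} (h : ToneEdgeColorable G t k) :
    toneChromaticIndex G t ≤ k :=
  iInf₂_le (f := fun (k : ℕ) (_ : k ∈ {k : ℕ | ToneEdgeColorable G t k}) => (k : ℕ∞)) k h

/-- Extending a pair coloring to one more edge. -/
theorem IsPairColoring.insert_edge [DecidableEq V] {S : Set (Sym2 V)} {f : Sym2 V → Finset (Fin 8)}
    (hf : IsPairColoring G S f) {p q : V} (hpq : p ≠ q) {c : Finset (Fin 8)} (hc : c.card = 2)
    (hS : s(p, q) ∉ S)
    (hq : ∀ r, p ≠ r → s(q, r) ∈ S → Disjoint c (f s(q, r)))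
    (hp : ∀ r, q ≠ r → s(p, r) ∈ S → Disjoint c (f s(p, r)))
    (hq2 : ∀ r t, G.Adj q r → s(r, t) ∈ S → p ≠ r → q ≠ t → p ≠ t → c ≠ f s(r, t))
    (hp2 : ∀ r t, G.Adj p r → s(r, t) ∈ S → q ≠ r → p ≠ t → q ≠ t → c ≠ f s(r, t)) :
    IsPairColoring G (insert s(p, q) S) (Function.update f s(p, q) c) := by
  have hupd : ∀ e ∈ S, Function.update f s(p, q) c e = f e := fun e he =>
    Function.update_of_ne (by rintro rfl; exact hS he) _ _
  constructor
  · rintro e (rfl | he)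
    · simpa using hc
    · rw [hupd e he]; exact hf.card e he
  · rintro a b d (h1 | h1) (h2 | h2) had
    · exfalso
      rcases Sym2.eq_iff.1 (h1.trans h2.symm) with ⟨rfl, rfl⟩ | ⟨h, -⟩
      exacts [had rfl, had h]
    · rw [hupd _ h2, h1, Function.update_self]
      rcases Sym2.eq_iff.1 h1 with ⟨rfl, rfl⟩ | ⟨rfl, rfl⟩
      exacts [hq d had h2, hp d had h2]
    · rw [hupd _ h1, h2, Function.update_self, disjoint_comm]
      rw [Sym2.eq_swap] at h1 ⊢
      rcases Sym2.eq_iff.1 h2 with ⟨rfl, rfl⟩ | ⟨rfl, rfl⟩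
      exacts [hp a had.symm h1, hq a had.symm h1]
    · rw [hupd _ h1, hupd _ h2]
      exact hf.disjoint a b d h1 h2 had
  · rintro a b d e (h1 | h1) hbd (h2 | h2) had hbe hae
    · exfalso
      rcases Sym2.eq_iff.1 (h1.trans h2.symm) with ⟨h, -⟩ | ⟨h, -⟩
      exacts [had h, hae h]
    · rw [hupd _ h2, h1, Function.update_self]
      rcases Sym2.eq_iff.1 h1 with ⟨rfl, rfl⟩ | ⟨rfl, rfl⟩
      exacts [hq2 d e hbd h2 had hbe hae, hp2 d e hbd h2 had hbe hae]
    · rw [hupd _ h1, h2, Function.update_self, ne_comm]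
      rw [Sym2.eq_swap] at h1 ⊢
      rcases Sym2.eq_iff.1 h2 with ⟨rfl, rfl⟩ | ⟨rfl, rfl⟩
      exacts [hp2 b a hbd.symm h1 hbe.symm had.symm hae.symm,
        hq2 b a hbd.symm h1 hbe.symm had.symm hae.symm]
    · rw [hupd _ h1, hupd _ h2]
      exact hf.ne a b d e h1 hbd h2 had hbe hae

/-- At least four colors remain, and they form at least six pairs. -/
theorem exists_pair (U : Finset (Fin 8)) (hU : U.card ≤ 4) (B : Finset (Finset (Fin 8)))
    (hB : B.card ≤ 5) : ∃ c : Finset (Fin 8), c.card = 2 ∧ Disjoint c U ∧ c ∉ B := by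
  have hcard : B.card < (Finset.powersetCard 2 Uᶜ).card := by
    rw [Finset.card_powersetCard, Finset.card_compl, Fintype.card_fin]
    calc B.card < Nat.choose 4 2 := by simpa [Nat.choose] using by omega
      _ ≤ Nat.choose (8 - U.card) 2 := Nat.choose_le_choose 2 (by omega)
  obtain ⟨c, hc, hcB⟩ := Finset.exists_mem_notMem_of_card_lt_card hcard
  rw [Finset.mem_powersetCard] at hc
  exact ⟨c, hc.2, (Finset.subset_compl_iff_disjoint_right.1 hc.1), hcB⟩

/-- Extending a pair coloring to one more edge if at most four colors occur on incident edges and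
at most five pairs of colors are forbidden. -/
theorem IsPairColoring.exists_insert_edge {S : Set (Sym2 V)} {f : Sym2 V → Finset (Fin 8)}
    (hf : IsPairColoring G S f) {p q : V} (hpq : p ≠ q) (hS : s(p, q) ∉ S)
    {U : Finset (Fin 8)} (hU : U.card ≤ 4) {B : Finset (Finset (Fin 8))} (hB : B.card ≤ 5)
    (hq : ∀ r, p ≠ r → s(q, r) ∈ S → f s(q, r) ⊆ U)
    (hp : ∀ r, q ≠ r → s(p, r) ∈ S → f s(p, r) ⊆ U)
    (hq2 : ∀ r t, G.Adj q r → s(r, t) ∈ S → p ≠ r → q ≠ t → p ≠ t → f s(r, t) ∈ B)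
    (hp2 : ∀ r t, G.Adj p r → s(r, t) ∈ S → q ≠ r → p ≠ t → q ≠ t → f s(r, t) ∈ B) :
    ∃ f', IsPairColoring G (insert s(p, q) S) f' := by
  classical
  obtain ⟨c, hc, hcU, hcB⟩ := exists_pair U hU B hB
  refine ⟨_, hf.insert_edge hpq hc hS (fun r h h' => hcU.mono_right (hq r h h'))
    (fun r h h' => hcU.mono_right (hp r h h'))
    (fun r t h1 h2 h3 h4 h5 e => hcB (e ▸ hq2 r t h1 h2 h3 h4 h5))
    (fun r t h1 h2 h3 h4 h5 e => hcB (e ▸ hp2 r t h1 h2 h3 h4 h5))⟩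

/-! ### Counting forbidden colors and pairs -/

section Counting

variable [Fintype V] [DecidableRel G.Adj] {S : Set (Sym2 V)} {f : Sym2 V → Finset (Fin 8)}

theorem IsPairColoring.exists_incident_colors (hf : IsPairColoring G S f) (hS : S ⊆ G.edgeSet)
    {p q : V} (hpq : G.Adj q p) {d : ℕ} (hd : G.degree q ≤ d + 1) :
    ∃ U : Finset (Fin 8), U.card ≤ d * 2 ∧ ∀ r, p ≠ r → s(q, r) ∈ S → f s(q, r) ⊆ U := by
  classical
  refine ⟨(((G.neighborFinset q).erase p).filter fun r => s(q, r) ∈ S).biUnion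
    fun r => f s(q, r), ?_, ?_⟩
  · refine (Finset.card_biUnion_le_card_mul _ _ 2 ?_).trans (Nat.mul_le_mul_right 2 ?_)
    · intro r hr
      exact (hf.card _ (Finset.mem_filter.1 hr).2).le
    · refine (Finset.card_filter_le _ _).trans ?_
      rw [Finset.card_erase_of_mem (by simpa using hpq), G.card_neighborFinset_eq_degree]
      omega
  · intro r hr hqr
    have : G.Adj q r := hS hqr
    exact Finset.subset_biUnion_of_mem (fun r => f s(q, r)) (by simp [hr.symm, hqr, this])

theorem exists_near_colors (hS : S ⊆ G.edgeSet) (f : Sym2 V → Finset (Fin 8))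
    (hdeg : ∀ v, G.degree v ≤ 3)
    {p q : V} (hpq : G.Adj q p) {d : ℕ} (hd : G.degree q ≤ d + 1) :
    ∃ B : Finset (Finset (Fin 8)), B.card ≤ d * 2 ∧
      ∀ r t, G.Adj q r → s(r, t) ∈ S → p ≠ r → q ≠ t → f s(r, t) ∈ B := by
  classical
  refine ⟨((G.neighborFinset q).erase p).biUnion fun r =>
    ((G.neighborFinset r).erase q).image fun t => f s(r, t), ?_, ?_⟩
  · refine (Finset.card_biUnion_le_card_mul _ _ 2 ?_).trans (Nat.mul_le_mul_right 2 ?_)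
    · intro r hr
      refine Finset.card_image_le.trans ?_
      have hqr : G.Adj r q := by simpa using ((Finset.mem_erase.1 hr).2 : r ∈ _) |> fun h =>
        ((G.mem_neighborFinset q r).1 h).symm
      rw [Finset.card_erase_of_mem (by simpa using hqr), G.card_neighborFinset_eq_degree]
      have := hdeg r
      omega
    · rw [Finset.card_erase_of_mem (by simpa using hpq), G.card_neighborFinset_eq_degree]
      omega
  · intro r t hqr hrt hpr hqt
    have : G.Adj r t := hS hrt
    simp only [Finset.mem_biUnion, Finset.mem_erase, SimpleGraph.mem_neighborFinset,
      Finset.mem_image]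
    exact ⟨r, ⟨hpr.symm, hqr⟩, t, ⟨hqt.symm, this⟩, rfl⟩

end Counting

/-- An edge of `G` joining ends of two edges that avoid `x` avoids `x` as well, so returning to `G`
adds no condition on the remaining edges. -/
theorem IsPairColoring.of_deleteIncidenceSet {x : V} {f : Sym2 V → Finset (Fin 8)}
    (hf : IsPairColoring (G.deleteIncidenceSet x) (G.deleteIncidenceSet x).edgeSet f) :
    IsPairColoring G (G.deleteIncidenceSet x).edgeSet f := by
  refine ⟨hf.card, hf.disjoint, fun p q r t h1 h2 h3 => hf.ne p q r t h1 ?_ h3⟩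
  rw [SimpleGraph.mem_edgeSet, SimpleGraph.deleteIncidenceSet_adj] at h1 h3
  exact SimpleGraph.deleteIncidenceSet_adj.2 ⟨h2, h1.2.2, h3.2.1⟩

theorem mem_edgeSet_deleteIncidenceSet {x p q : V} :
    s(p, q) ∈ (G.deleteIncidenceSet x).edgeSet ↔ G.Adj p q ∧ p ≠ x ∧ q ≠ x :=
  SimpleGraph.deleteIncidenceSet_adj

/-- The statement that the graph has a pair coloring of all its edges. -/
def PairColorable (G : SimpleGraph V) : Prop := ∃ f, IsPairColoring G G.edgeSet f

theorem PairColorable.of_insert {x y : V} (hxy : G.Adj x y) (hx : ∀ z, G.Adj x z → z = y)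
    (h : ∃ f, IsPairColoring G (insert s(x, y) (G.deleteIncidenceSet x).edgeSet) f) :
    PairColorable G := by
  obtain ⟨f, hf⟩ := h
  refine ⟨f, ?_⟩
  convert hf
  ext ⟨p, q⟩
  change G.Adj p q ↔ s(p, q) = s(x, y) ∨ s(p, q) ∈ _
  rw [mem_edgeSet_deleteIncidenceSet, Sym2.eq_iff]
  constructor
  · intro h
    by_cases hp : p = x
    · subst hp; exact .inl (.inl ⟨rfl, hx _ h⟩)
    by_cases hq : q = x
    · subst hq; exact .inl (.inr ⟨hx _ h.symm, rfl⟩)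
    · exact .inr ⟨h, hp, hq⟩
  · rintro ((⟨rfl, rfl⟩ | ⟨rfl, rfl⟩) | h)
    exacts [hxy, hxy.symm, h.1]

theorem PairColorable.of_insert_insert {x y z : V} (hxy : G.Adj x y) (hxz : G.Adj x z)
    (hx : ∀ w, G.Adj x w → w = y ∨ w = z)
    (h : ∃ f, IsPairColoring G
      (insert s(x, y) (insert s(x, z) (G.deleteIncidenceSet x).edgeSet)) f) :
    PairColorable G := by
  obtain ⟨f, hf⟩ := h
  refine ⟨f, ?_⟩
  convert hf
  ext ⟨p, q⟩
  change G.Adj p q ↔ s(p, q) = s(x, y) ∨ s(p, q) = s(x, z) ∨ s(p, q) ∈ _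
  rw [mem_edgeSet_deleteIncidenceSet, Sym2.eq_iff, Sym2.eq_iff]
  constructor
  · intro h
    by_cases hp : p = x
    · subst hp
      rcases hx _ h with rfl | rfl <;> simp
    by_cases hq : q = x
    · subst hq
      rcases hx _ h.symm with rfl | rfl <;> simp
    · exact .inr (.inr ⟨h, hp, hq⟩)
  · rintro ((⟨rfl, rfl⟩ | ⟨rfl, rfl⟩) | (⟨rfl, rfl⟩ | ⟨rfl, rfl⟩) | h)
    exacts [hxy, hxy.symm, hxz, hxz.symm, h.1]

theorem edgeSet_deleteIncidenceSet_subset (x : V) :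
    (G.deleteIncidenceSet x).edgeSet ⊆ G.edgeSet :=
  SimpleGraph.edgeSet_mono (G.deleteIncidenceSet_le x)

/-! ### Reducible configurations -/

section Reductions

variable [Fintype V] [DecidableRel G.Adj]

/-- A vertex of degree one is reducible. -/
theorem PairColorable.of_degree_eq_one (hdeg : ∀ v, G.degree v ≤ 3) {x y : V} (hxy : G.Adj x y)
    (hx : ∀ z, G.Adj x z → z = y) (h : PairColorable (G.deleteIncidenceSet x)) :
    PairColorable G := by
  obtain ⟨f, hf⟩ := h
  replace hf := hf.of_deleteIncidenceSet
  have hS := edgeSet_deleteIncidenceSet_subset (G := G) x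
  obtain ⟨U, hU, hUq⟩ := hf.exists_incident_colors hS hxy.symm (d := 2) (hdeg y)
  obtain ⟨B, hB, hBq⟩ := exists_near_colors hS f hdeg hxy.symm (d := 2) (hdeg y)
  refine .of_insert hxy hx (hf.exists_insert_edge hxy.ne ?_ hU (hB.trans (by norm_num)) hUq ?_
    (fun r t h1 h2 h3 h4 _ => hBq r t h1 h2 h3 h4) ?_)
  · rw [mem_edgeSet_deleteIncidenceSet]; simp
  · intro r _ h
    rw [mem_edgeSet_deleteIncidenceSet] at h
    exact (h.2.1 rfl).elim
  · intro r t h1 _ h3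
    exact (h3 (hx r h1).symm).elim

/-- Two adjacent vertices of degree two are reducible. -/
theorem PairColorable.of_adj_degree_le_two (hdeg : ∀ v, G.degree v ≤ 3) {x y z : V}
    (hxy : G.Adj x y) (hxz : G.Adj x z) (hyz : y ≠ z) (hx : ∀ w, G.Adj x w → w = y ∨ w = z)
    (hy : G.degree y ≤ 2) (h : PairColorable (G.deleteIncidenceSet x)) : PairColorable G := by
  classical
  obtain ⟨f, hf⟩ := h
  replace hf := hf.of_deleteIncidenceSet
  have hS := edgeSet_deleteIncidenceSet_subset (G := G) x
  have hcard_y : ((G.neighborFinset y).erase x).card ≤ 1 := by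
    rw [Finset.card_erase_of_mem (by simpa using hxy.symm), G.card_neighborFinset_eq_degree]
    omega
  -- The edge `s(x, z)` is colored first: it sees at most four colors at `z`, four pairs beyond `z`
  -- and one pair at `y`, exactly what `exists_pair` allows.
  obtain ⟨f', hf'⟩ : ∃ f', IsPairColoring G
      (insert s(x, z) (G.deleteIncidenceSet x).edgeSet) f' := by
    obtain ⟨U, hU, hUq⟩ := hf.exists_incident_colors hS hxz.symm (d := 2) (hdeg z)
    obtain ⟨B, hB, hBq⟩ := exists_near_colors hS f hdeg hxz.symm (d := 2) (hdeg z)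
    refine hf.exists_insert_edge hxz.ne ?_ hU
      (B := B ∪ ((G.neighborFinset y).erase x).image fun t => f s(y, t)) ?_ hUq ?_
      (fun r t h1 h2 h3 h4 _ => Finset.mem_union_left _ (hBq r t h1 h2 h3 h4)) ?_
    · rw [mem_edgeSet_deleteIncidenceSet]; simp
    · refine (Finset.card_union_le _ _).trans ?_
      have := (Finset.card_image_le (s := (G.neighborFinset y).erase x)
        (f := fun t => f s(y, t))).trans hcard_y
      omega
    · intro r _ h
      rw [mem_edgeSet_deleteIncidenceSet] at h
      exact (h.2.1 rfl).elim
    · intro r t h1 h2 h3 h4 h5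
      obtain rfl := (hx r h1).resolve_right h3.symm
      rw [mem_edgeSet_deleteIncidenceSet] at h2
      refine Finset.mem_union_right _ (Finset.mem_image.2 ⟨t, ?_, rfl⟩)
      simp [h4.symm, h2.1]
  have hS' : insert s(x, z) (G.deleteIncidenceSet x).edgeSet ⊆ G.edgeSet :=
    Set.insert_subset hxz hS
  obtain ⟨U₁, hU₁, hUy⟩ := hf'.exists_incident_colors hS' hxy.symm (d := 1) hy
  obtain ⟨B₁, hB₁, hBy⟩ := exists_near_colors hS' f' hdeg hxy.symm (d := 1) hy
  have hz : ((G.neighborFinset z).erase x).card ≤ 2 := by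
    rw [Finset.card_erase_of_mem (by simpa using hxz.symm), G.card_neighborFinset_eq_degree]
    have := hdeg z
    omega
  -- For `s(x, y)` there are at most two colors at `y` and two on `s(x, z)`, and at most two pairs
  -- beyond `y` and two at `z`.
  refine .of_insert_insert hxy hxz hx (hf'.exists_insert_edge hxy.ne ?_ (U := U₁ ∪ f' s(x, z))
    (B := B₁ ∪ ((G.neighborFinset z).erase x).image fun t => f' s(z, t)) ?_ ?_
    (fun r h1 h2 => (hUy r h1 h2).trans Finset.subset_union_left) ?_
    (fun r t h1 h2 h3 h4 _ => Finset.mem_union_left _ (hBy r t h1 h2 h3 h4)) ?_)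
  · rintro (h | h)
    · rcases Sym2.eq_iff.1 h with ⟨-, h⟩ | ⟨h, -⟩
      exacts [hyz h, hxz.ne h]
    · rw [mem_edgeSet_deleteIncidenceSet] at h
      exact h.2.1 rfl
  · refine (Finset.card_union_le _ _).trans ?_
    rw [hf'.card _ (Set.mem_insert _ _)]
    omega
  · refine (Finset.card_union_le _ _).trans ?_
    have := (Finset.card_image_le (s := (G.neighborFinset z).erase x)
      (f := fun t => f' s(z, t))).trans hz
    omega
  · intro r h1 h2
    obtain rfl := (hx r (hS' h2)).resolve_left h1.symm
    exact Finset.subset_union_right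
  · intro r t h1 h2 h3 h4 h5
    obtain rfl := (hx r h1).resolve_left h3.symm
    refine Finset.mem_union_right _ (Finset.mem_image.2 ⟨t, ?_, rfl⟩)
    have : G.Adj r t := hS' h2
    simp [h4.symm, this]

/-- The choice of colors that makes a triangle with a vertex of degree two reducible. -/
theorem exists_triangle_pairs {C D E : Finset (Fin 8)} (hC : C.card = 2) (hD : D.card = 2)
    (hE : E.card = 2) (hDE : Disjoint D E) (hCD : C ≠ D)
    {X Y : Finset (Finset (Fin 8))} (hX : ∀ s ∈ X, ∀ t ∈ X, s ≠ t → Disjoint s t)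
    (hY : ∀ s ∈ Y, ∀ t ∈ Y, s ≠ t → Disjoint s t) :
    ∃ A B : Finset (Fin 8), A.card = 2 ∧ B.card = 2 ∧ Disjoint A E ∧ Disjoint A C ∧
      Disjoint B E ∧ Disjoint B D ∧ Disjoint B A ∧ A ≠ D ∧ B ≠ C ∧ A ∉ X ∧ B ∉ Y := by
  -- `A` reuses a color of `D`, which `B` has to avoid anyway. Thus `A = {δ, z}` costs `B` only the
  -- color `z`.
  obtain ⟨δ, hδD, hδC⟩ : ∃ δ ∈ D, δ ∉ C := by
    by_contra! h
    exact hCD (Finset.eq_of_subset_of_card_le h (by omega)).symm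
  have hδE : δ ∉ E := Finset.disjoint_left.1 hDE hδD
  have hZ : 1 < ((C ∪ D ∪ E)ᶜ).card := by
    have h1 := Finset.card_union_le (C ∪ D) E
    have h2 := Finset.card_union_le C D
    rw [Finset.card_compl, Fintype.card_fin]
    omega
  -- Two candidates for `z` give two different pairs containing `δ`; members of `X` are pairwise
  -- disjoint, so one of these pairs is not in `X`.
  obtain ⟨z, hz, hzX⟩ : ∃ z ∈ (C ∪ D ∪ E)ᶜ, ({δ, z} : Finset (Fin 8)) ∉ X := by
    by_contra! h
    obtain ⟨z₁, h₁, z₂, h₂, hne⟩ := Finset.one_lt_card.1 hZ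
    have hne' : ({δ, z₁} : Finset (Fin 8)) ≠ {δ, z₂} := by
      intro e
      have : z₁ ∈ ({δ, z₂} : Finset (Fin 8)) := e ▸ by simp
      simp only [Finset.mem_insert, Finset.mem_singleton, hne, or_false] at this
      subst this
      simp [hδD] at h₁
    exact Finset.disjoint_left.1 (hX _ (h z₁ h₁) _ (h z₂ h₂) hne')
      (Finset.mem_insert_self _ _) (Finset.mem_insert_self _ _)
  simp only [Finset.mem_compl, Finset.mem_union, not_or] at hz
  obtain ⟨⟨hzC, hzD⟩, hzE⟩ := hz
  have hδz : δ ≠ z := fun e => hzD (e ▸ hδD)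
  -- Three colors give three pairs, at least two of them different from `C`. Any two pairs within
  -- three colors meet, so `Y` contains at most one of them.
  have hW : 3 ≤ ((insert z (D ∪ E))ᶜ).card := by
    have h1 := Finset.card_insert_le z (D ∪ E)
    have h2 := Finset.card_union_le D E
    rw [Finset.card_compl, Fintype.card_fin]
    omega
  obtain ⟨W, hWsub, hW⟩ := Finset.exists_subset_card_eq hW
  have hP : 1 < ((Finset.powersetCard 2 W).erase C).card := by
    have := Finset.pred_card_le_card_erase (s := Finset.powersetCard 2 W) (a := C)
    rw [Finset.card_powersetCard, hW] at this
    simp only [Nat.choose] at this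
    omega
  obtain ⟨B, hB, hBY⟩ : ∃ B ∈ (Finset.powersetCard 2 W).erase C, B ∉ Y := by
    by_contra! h
    obtain ⟨B₁, h₁, B₂, h₂, hne⟩ := Finset.one_lt_card.1 hP
    have hdis := hY _ (h B₁ h₁) _ (h B₂ h₂) hne
    simp only [Finset.mem_erase, Finset.mem_powersetCard] at h₁ h₂
    have := Finset.card_le_card (Finset.union_subset h₁.2.1 h₂.2.1)
    rw [Finset.card_union_of_disjoint hdis, h₁.2.2, h₂.2.2, hW] at this
    omega
  simp only [Finset.mem_erase, Finset.mem_powersetCard] at hB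
  have hBW : ∀ b ∈ B, b ≠ z ∧ b ∉ D ∧ b ∉ E := fun b hb => by
    simpa using hWsub (hB.2.1 hb)
  refine ⟨{δ, z}, B, Finset.card_pair hδz, hB.2.2, by simp [hδE, hzE], by simp [hδC, hzC],
    Finset.disjoint_left.2 fun b hb => (hBW b hb).2.2,
    Finset.disjoint_left.2 fun b hb => (hBW b hb).2.1,
    Finset.disjoint_left.2 fun b hb hmem => ?_, fun e => hzD (e ▸ by simp), hB.1, hzX, hBY⟩
  rcases Finset.mem_insert.1 hmem with rfl | hmem
  · exact (hBW b hb).2.1 hδD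
  · exact (hBW b hb).1 (Finset.mem_singleton.1 hmem)

/-- The colors seen from `u` beyond the triangle `u v w`: a pair `C` at `u` and pairwise disjoint
pairs at the third neighbor of `u`. -/
structure OuterColors (G : SimpleGraph V) (f : Sym2 V → Finset (Fin 8)) (u v w : V)
    (C : Finset (Fin 8)) (X : Finset (Finset (Fin 8))) : Prop where
  disjoint : ∀ s ∈ X, ∀ t ∈ X, s ≠ t → Disjoint s t
  eq : ∀ r, G.Adj u r → r ≠ v → r ≠ w → f s(u, r) = C
  mem : ∀ r, G.Adj u r → r ≠ v → r ≠ w → ∀ t, G.Adj r t → t ≠ u → t ≠ w → f s(r, t) ∈ X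

/-- Subcubicity leaves `r` as the only neighbor of `u` beyond `v` and `w`. The pairs at `r` are
disjoint because their edges are incident; an edge from `r` to `w` is left out, as it is not yet
colored. -/
theorem IsPairColoring.exists_outerColors (hdeg : ∀ v, G.degree v ≤ 3) {u v w r : V}
    {f : Sym2 V → Finset (Fin 8)} (hf : IsPairColoring G (G.deleteIncidenceSet w).edgeSet f)
    (huv : G.Adj u v) (huw : G.Adj u w) (hvw : v ≠ w) (hur : G.Adj u r) (hrv : r ≠ v)
    (hrw : r ≠ w) : ∃ X, OuterColors G f u v w (f s(u, r)) X := by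
  classical
  have huniq : ∀ r', G.Adj u r' → r' ≠ v → r' ≠ w → r' = r := by
    intro r' h1 h2 h3
    by_contra hne
    have hsub : ({v, w, r, r'} : Finset V) ⊆ G.neighborFinset u := by
      intro z
      simp only [Finset.mem_insert, Finset.mem_singleton, SimpleGraph.mem_neighborFinset]
      rintro (rfl | rfl | rfl | rfl) <;> assumption
    have h4 : ({v, w, r, r'} : Finset V).card = 4 := by
      rw [Finset.card_insert_of_notMem, Finset.card_insert_of_notMem, Finset.card_pair] <;>
        simp [hvw, hrv.symm, hrw.symm, h2.symm, h3.symm, Ne.symm hne]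
    have := Finset.card_le_card hsub
    rw [h4, G.card_neighborFinset_eq_degree] at this
    have := hdeg u
    omega
  refine ⟨((G.neighborFinset r).filter fun t => t ≠ w).image fun t => f s(r, t), ?_, ?_, ?_⟩
  · simp only [Finset.mem_image, Finset.mem_filter, SimpleGraph.mem_neighborFinset]
    rintro _ ⟨t, ⟨ht, htw⟩, rfl⟩ _ ⟨t', ⟨ht', htw'⟩, rfl⟩ hne
    rw [Sym2.eq_swap]
    refine hf.disjoint t r t' ?_ ?_ ?_
    · exact mem_edgeSet_deleteIncidenceSet.2 ⟨ht.symm, htw, hrw⟩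
    · exact mem_edgeSet_deleteIncidenceSet.2 ⟨ht', hrw, htw'⟩
    · rintro rfl
      exact hne rfl
  · intro r' h1 h2 h3
    rw [huniq r' h1 h2 h3]
  · intro r' h1 h2 h3 t h4 h5 h6
    obtain rfl := huniq r' h1 h2 h3
    exact Finset.mem_image_of_mem _ (by simp [h4, h6])

/-- A triangle with a vertex of degree two is reducible. -/
theorem PairColorable.of_triangle (hdeg : ∀ v, G.degree v ≤ 3) {u v w : V} (huv : G.Adj u v)
    (hwu : G.Adj w u) (hwv : G.Adj w v) (hw : ∀ z, G.Adj w z → z = v ∨ z = u)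
    (h : PairColorable (G.deleteIncidenceSet w)) : PairColorable G := by
  classical
  obtain ⟨f, hf⟩ := h
  replace hf := hf.of_deleteIncidenceSet
  have hS := edgeSet_deleteIncidenceSet_subset (G := G) w
  have hmem : ∀ {p q}, s(p, q) ∈ (G.deleteIncidenceSet w).edgeSet ↔ G.Adj p q ∧ p ≠ w ∧ q ≠ w :=
    mem_edgeSet_deleteIncidenceSet
  set E := f s(u, v) with hEdef
  have hE : E.card = 2 := hf.card _ (hmem.2 ⟨huv, hwu.ne', hwv.ne'⟩)
  obtain ⟨C, D, X, Y, hC, hD, hDE, hCD, hX, hY⟩ : ∃ C D X Y, C.card = 2 ∧ D.card = 2 ∧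
      Disjoint D E ∧ C ≠ D ∧ OuterColors G f u v w C X ∧ OuterColors G f v u w D Y := by
    by_cases hu : ∃ r, G.Adj u r ∧ r ≠ v ∧ r ≠ w
    · obtain ⟨r, hur, hrv, hrw⟩ := hu
      obtain ⟨X, hX⟩ := hf.exists_outerColors hdeg huv hwu.symm hwv.ne' hur hrv hrw
      have hurS := hmem.2 ⟨hur, hwu.ne', hrw⟩
      by_cases hv : ∃ r, G.Adj v r ∧ r ≠ u ∧ r ≠ w
      · obtain ⟨t, hvt, htu, htw⟩ := hv
        obtain ⟨Y, hY⟩ := hf.exists_outerColors hdeg huv.symm hwv.symm hwu.ne' hvt htu htw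
        have hvtS := hmem.2 ⟨hvt, hwv.ne', htw⟩
        refine ⟨_, _, X, Y, hf.card _ hurS, hf.card _ hvtS, ?_, ?_, hX, hY⟩
        · rw [hEdef, Sym2.eq_swap (a := v), disjoint_comm, Sym2.eq_swap (a := t)]
          exact hf.disjoint u v t (hmem.2 ⟨huv, hwu.ne', hwv.ne'⟩) hvtS htu.symm
        -- The outer edges at `u` and `v` are either incident, with disjoint nonempty pairs, or
        -- joined by the edge `s(u, v)`.
        · rw [Sym2.eq_swap (a := u)]
          rcases eq_or_ne r t with rfl | hrt
          · intro e
            have := hf.disjoint u r v hurS (by rwa [Sym2.eq_swap]) huv.ne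
            rw [Sym2.eq_swap, Sym2.eq_swap (a := r) (b := v), ← e, disjoint_self,
              Finset.bot_eq_empty, ← Finset.card_eq_zero, Sym2.eq_swap, hf.card _ hurS] at this
            omega
          · exact hf.ne r u v t (by rwa [Sym2.eq_swap]) huv hvtS hrv htu.symm hrt
      -- A missing outer edge is replaced by a dummy pair that meets the requirements of
      -- `exists_triangle_pairs`.
      · obtain ⟨D, hD, hDE, hDC⟩ := exists_pair E (by omega) {f s(u, r)} (by simp)
        refine ⟨_, D, X, ∅, hf.card _ hurS, hD, hDE, ?_, hX, by simp, ?_, ?_⟩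
        · rintro rfl
          simp at hDC
        · exact fun r h1 h2 h3 => (hv ⟨r, h1, h2, h3⟩).elim
        · exact fun r h1 h2 h3 => (hv ⟨r, h1, h2, h3⟩).elim
    · obtain ⟨D, Y, hD, hDE, hY⟩ : ∃ D Y, D.card = 2 ∧ Disjoint D E ∧
          OuterColors G f v u w D Y := by
        by_cases hv : ∃ r, G.Adj v r ∧ r ≠ u ∧ r ≠ w
        · obtain ⟨t, hvt, htu, htw⟩ := hv
          obtain ⟨Y, hY⟩ := hf.exists_outerColors hdeg huv.symm hwv.symm hwu.ne' hvt htu htw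
          have hvtS := hmem.2 ⟨hvt, hwv.ne', htw⟩
          refine ⟨_, Y, hf.card _ hvtS, ?_, hY⟩
          rw [hEdef, disjoint_comm]
          exact hf.disjoint u v t (hmem.2 ⟨huv, hwu.ne', hwv.ne'⟩) hvtS htu.symm
        · obtain ⟨D, hD, hDE, -⟩ := exists_pair E (by omega) ∅ (by simp)
          exact ⟨D, ∅, hD, hDE, by simp, fun r h1 h2 h3 => (hv ⟨r, h1, h2, h3⟩).elim,
            fun r h1 h2 h3 => (hv ⟨r, h1, h2, h3⟩).elim⟩
      obtain ⟨C, hC, -, hCD⟩ := exists_pair E (by omega) {D} (by simp)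
      exact ⟨C, D, ∅, Y, hC, hD, hDE, by simpa using hCD,
        ⟨by simp, fun r h1 h2 h3 => (hu ⟨r, h1, h2, h3⟩).elim,
          fun r h1 h2 h3 => (hu ⟨r, h1, h2, h3⟩).elim⟩, hY⟩
  obtain ⟨A, B, hA, hB, hAE, hAC, hBE, hBD, hBA, hAD, hBC, hAX, hBY⟩ :=
    exists_triangle_pairs hC hD hE hDE hCD hX.disjoint hY.disjoint
  have hnot : ∀ {p}, s(w, p) ∉ (G.deleteIncidenceSet w).edgeSet := fun h => (hmem.1 h).2.1 rfl
  have hf' : IsPairColoring G _ _ := hf.insert_edge (p := w) (q := u) hwu.ne hA hnot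
    (by
      intro r hr h
      rcases eq_or_ne r v with rfl | hrv
      · exact hAE
      · rw [hX.eq r (hmem.1 h).1 hrv hr.symm]; exact hAC)
    (fun r _ h => (hnot h).elim)
    (by
      intro r t h1 h2 h3 h4 h5
      rcases eq_or_ne r v with rfl | hrv
      · rw [hY.eq t (hmem.1 h2).1 h4.symm h5.symm]; exact hAD
      · exact fun e => hAX (e ▸ hX.mem r h1 hrv h3.symm t (hmem.1 h2).1 h4.symm h5.symm))
    (by
      intro r t h1 h2 h3 h4 h5
      obtain rfl := (hw r h1).resolve_right h3.symm
      rw [hY.eq t (hmem.1 h2).1 h5.symm h4.symm]; exact hAD)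
  have hne : s(w, v) ≠ s(w, u) := by
    intro h
    rcases Sym2.eq_iff.1 h with ⟨-, h⟩ | ⟨h, -⟩
    exacts [huv.ne' h, hwu.ne h]
  have hold : ∀ {p q}, p ≠ w → q ≠ w →
      Function.update f s(w, u) A s(p, q) = f s(p, q) := fun {p q} hp hq =>
    Function.update_of_ne (by simp [hp, hq]) _ _
  have hin : ∀ {p q}, p ≠ w → q ≠ w → s(p, q) ∈ insert s(w, u) (G.deleteIncidenceSet w).edgeSet →
      G.Adj p q := fun {p q} hp hq h => hS (h.resolve_left (by simp [hp, hq]))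
  refine .of_insert_insert hwv hwu hw ⟨_, hf'.insert_edge hwv.ne hB ?_ ?_ ?_ ?_ ?_⟩
  · rintro (h | h)
    exacts [hne h, hnot h]
  · intro r hr h
    rw [hold hwv.ne' hr.symm]
    rcases eq_or_ne r u with rfl | hru
    · rw [Sym2.eq_swap]; exact hBE
    · rw [hY.eq r (hin hwv.ne' hr.symm h) hru hr.symm]; exact hBD
  · intro r hr h
    obtain rfl : r = u := by
      rcases h with h | h
      · exact (Sym2.congr_right.1 h)
      · exact (hnot h).elim
    rw [Function.update_self]; exact hBA
  · intro r t h1 h2 h3 h4 h5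
    rw [hold h3.symm h5.symm]
    rcases eq_or_ne r u with rfl | hru
    · rw [hX.eq t (hin h3.symm h5.symm h2) h4.symm h5.symm]; exact hBC
    · exact fun e => hBY (e ▸ hY.mem r h1 hru h3.symm t (hin h3.symm h5.symm h2) h4.symm h5.symm)
  · intro r t h1 h2 h3 h4 h5
    obtain rfl := (hw r h1).resolve_left h3.symm
    rw [hold hwu.ne' h4.symm]
    rw [hX.eq t (hin hwu.ne' h4.symm h2) h5.symm h4.symm]; exact hBC

end Reductions

end Coloring

/-! ### Cycles, ears and maximal separated pairs -/

section Cycles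

variable {V : Type*} {G : SimpleGraph V}

theorem ConnectedSet.union_of_mem {S T : Set V} (hS : ConnectedSet G S) (hT : ConnectedSet G T)
    {x : V} (hx : x ∈ S) (hx' : x ∈ T) : ConnectedSet G (S ∪ T) := by
  have h1 : ∀ u ∈ S ∪ T, LinkedIn G (S ∪ T) u x := by
    rintro u (hu | hu)
    · exact (hS u hu x hx).mono Set.subset_union_left
    · exact (hT u hu x hx').mono Set.subset_union_right
  exact fun u hu v hv => (h1 u hu).trans (h1 v hv).symm

theorem connectedSet_of_isChain {l : List V} (h : l.IsChain G.Adj) :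
    ConnectedSet G {x | x ∈ l} := by
  induction l with
  | nil => intro u hu; simp at hu
  | cons a l ih =>
    cases l with
    | nil =>
      intro u hu v hv
      have hu' : u = a := by simpa using hu
      have hv' : v = a := by simpa using hv
      subst hu' hv'
      exact .refl hu
    | cons b l =>
      rw [List.isChain_cons_cons] at h
      have hsing : ConnectedSet G {a} := by
        rintro u rfl v rfl
        exact .refl rfl
      have := hsing.union (ih h.2) (x := a) (y := b) rfl (by simp) h.1
      convert this using 1
      ext x
      simp

/-- The interior of a nontrivial path is adjacent to both ends. -/
theorem exists_adj_of_isChain {a b : V} {A : List V} (h : (a :: (A ++ [b])).IsChain G.Adj)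
    (hA : A ≠ []) : (∃ x ∈ A, G.Adj a x) ∧ ∃ x ∈ A, G.Adj b x := by
  constructor
  · cases A with
    | nil => exact (hA rfl).elim
    | cons x A => exact ⟨x, by simp, (List.isChain_cons_cons.1 h).1⟩
  · rcases List.eq_nil_or_concat A with rfl | ⟨A', x, rfl⟩
    · exact (hA rfl).elim
    · refine ⟨x, by simp, ?_⟩
      have h' : (a :: (A' ++ x :: b :: [])).IsChain G.Adj := by simpa using h
      exact (List.isChain_cons_append_cons_cons.1 h').2.1.symm

theorem isChain_reverse_of_isChain {l : List V} (h : l.IsChain G.Adj) :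
    l.reverse.IsChain G.Adj := by
  rw [List.isChain_reverse]
  exact h.imp fun _ _ h => h.symm

/-- The list of vertices of a cycle of `G`, in cyclic order. -/
structure IsCycleList (G : SimpleGraph V) (l : List V) : Prop where
  nodup : l.Nodup
  three_le : 3 ≤ l.length
  chain : Cycle.Chain G.Adj (l : Cycle V)

theorem IsCycleList.rotate {A B : List V} (h : IsCycleList G (A ++ B)) :
    IsCycleList G (B ++ A) := by
  have hr : (A ++ B).IsRotated (B ++ A) := List.isRotated_append
  refine ⟨hr.nodup_iff.1 h.nodup, ?_, ?_⟩
  · rw [← hr.perm.length_eq]; exact h.three_le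
  · rw [← Cycle.coe_eq_coe.2 hr]; exact h.chain

theorem chain_iff_of_split {a b : V} {A B : List V} :
    Cycle.Chain G.Adj ((a :: (A ++ b :: B) : List V) : Cycle V) ↔
      (a :: (A ++ [b])).IsChain G.Adj ∧ (b :: (B ++ [a])).IsChain G.Adj := by
  rw [Cycle.chain_coe_cons, List.append_assoc, List.cons_append, List.isChain_cons_split]

theorem IsCycleList.connectedSet {l : List V} (h : IsCycleList G l) :
    ConnectedSet G {x | x ∈ l} := by
  cases l with
  | nil => intro u hu; simp at hu
  | cons a l =>
    have h' := Cycle.chain_coe_cons _ _ _ |>.1 h.chain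
    rw [← List.cons_append] at h'
    exact connectedSet_of_isChain h'.left_of_append

theorem IsCycleList.exists_rotate {l : List V} (h : IsCycleList G l) {a : V} (ha : a ∈ l) :
    ∃ x y M, IsCycleList G (a :: x :: (M ++ [y])) ∧ (a :: x :: (M ++ [y])).Perm l := by
  obtain ⟨A, B, rfl⟩ := List.append_of_mem ha
  have h' := h.rotate
  have hp : (a :: B ++ A).Perm (A ++ a :: B) := List.perm_append_comm
  rw [List.cons_append] at h' hp
  generalize B ++ A = R at h' hp
  have hlen := h'.three_le
  match R, hlen with
  | x :: R, hlen =>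
    rcases List.eq_nil_or_concat R with rfl | ⟨M, y, rfl⟩
    · simp at hlen
    · exact ⟨x, y, M, by simpa using h', by simpa using hp⟩

theorem IsCycleList.adj_of_split {a x y : V} {M : List V}
    (h : IsCycleList G (a :: x :: (M ++ [y]))) : G.Adj a x ∧ G.Adj a y := by
  have := chain_iff_of_split (A := x :: M) (B := []) |>.1 h.chain
  exact ⟨(List.isChain_cons_cons.1 this.1).1, by simpa [SimpleGraph.adj_comm] using this.2⟩

/-- `K` is connected, `C` is a cycle disjoint from `K`, and `K` is adjacent to `C` unless it is
empty. -/
structure Separated (G : SimpleGraph V) (K : Set V) (C : List V) : Prop where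
  connected : ConnectedSet G K
  cycle : IsCycleList G C
  notMem : ∀ x ∈ C, x ∉ K
  attached : K.Nonempty → ∃ x ∈ K, ∃ c ∈ C, G.Adj x c

theorem Separated.of_perm {K : Set V} {C C' : List V} (h : Separated G K C)
    (hC' : IsCycleList G C') (hp : C'.Perm C) : Separated G K C' := by
  refine ⟨h.connected, hC', fun x hx => h.notMem x (hp.mem_iff.1 hx), fun hK => ?_⟩
  obtain ⟨x, hx, c, hc, hxc⟩ := h.attached hK
  exact ⟨x, hx, c, hp.mem_iff.2 hc, hxc⟩

theorem Separated.rotate {K : Set V} {A B : List V} (h : Separated G K (A ++ B)) :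
    Separated G K (B ++ A) :=
  h.of_perm h.cycle.rotate List.perm_append_comm

theorem Separated.connected_union {K : Set V} {C : List V} (h : Separated G K C) :
    ConnectedSet G (K ∪ {x | x ∈ C}) := by
  rcases K.eq_empty_or_nonempty with rfl | hK
  · simpa using h.cycle.connectedSet
  · obtain ⟨x, hx, c, hc, hxc⟩ := h.attached hK
    exact h.connected.union h.cycle.connectedSet hx hc hxc

/-- The vertex `c` has a neighbor in `K`. -/
def Attached (G : SimpleGraph V) (K : Set V) (c : V) : Prop := ∃ x ∈ K, G.Adj c x

/-- Rerouting the cycle along an ear. -/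
theorem Separated.reroute {K : Set V} {a b : V} {A B Q : List V}
    (h : Separated G K (a :: (A ++ b :: B))) (hQ : (b :: (Q ++ [a])).IsChain G.Adj)
    (hQn : Q.Nodup) (hQK : ∀ q ∈ Q, q ∉ K) (hQC : ∀ q ∈ Q, q ∉ a :: (A ++ b :: B))
    (hatt : ∀ c, Attached G K c → c ∈ a :: (A ++ b :: B) → c ∈ B) (hB : B ≠ [])
    (hAQ : A ≠ [] ∨ Q ≠ []) : Separated G (K ∪ {x | x ∈ B}) (a :: (A ++ b :: Q)) := by
  have hch := chain_iff_of_split.1 h.cycle.chain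
  have hnd := h.cycle.nodup
  have hBconn : ConnectedSet G {x | x ∈ B} := by
    have := hch.2
    rw [← List.singleton_append] at this
    exact connectedSet_of_isChain this.right_of_append.left_of_append
  refine ⟨?_, ⟨?_, ?_, chain_iff_of_split.2 ⟨hch.1, hQ⟩⟩, ?_, ?_⟩
  · rcases K.eq_empty_or_nonempty with rfl | hK
    · simpa using hBconn
    · obtain ⟨x, hx, c, hc, hxc⟩ := h.attached hK
      exact h.connected.union hBconn hx (hatt c ⟨x, hx, hxc.symm⟩ hc) hxc
  · grind
  · have := h.cycle.three_le
    have : 0 < A.length ∨ 0 < Q.length := by simpa [List.length_pos_iff] using hAQ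
    simp
    omega
  · intro x hx
    rintro (hK | hxB)
    · by_cases hxQ : x ∈ Q
      · exact hQK x hxQ hK
      · exact h.notMem x (by grind) hK
    · have hxB' : x ∈ B := hxB
      grind
  · intro _
    obtain ⟨x, hx, hbx⟩ := (exists_adj_of_isChain hch.2 hB).1
    exact ⟨x, .inr hx, b, by simp, hbx.symm⟩

/-- The three connected sets are the two open arcs of the cycle between `a` and `b`, and `K`. -/
theorem Separated.hasThetaMinor {K : Set V} {a b : V} {A B : List V}
    (h : Separated G K (a :: (A ++ b :: B))) (hA : A ≠ []) (hB : B ≠ [])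
    (ha : Attached G K a) (hb : Attached G K b) : HasThetaMinor G := by
  have hch := chain_iff_of_split.1 h.cycle.chain
  have hnd := h.cycle.nodup
  have hint : ∀ {a b : V} {A : List V}, (a :: (A ++ [b])).IsChain G.Adj →
      ConnectedSet G {x | x ∈ A} := by
    intro a b A this
    rw [← List.singleton_append] at this
    exact connectedSet_of_isChain this.right_of_append.left_of_append
  have hAadj := exists_adj_of_isChain hch.1 hA
  have hBadj := exists_adj_of_isChain hch.2 hB
  have hAB : Disjoint {x | x ∈ A} {x | x ∈ B} := Set.disjoint_left.2 fun x hx hx' => by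
    have h1 : x ∈ A := hx
    have h2 : x ∈ B := hx'
    grind
  have hAK : Disjoint {x | x ∈ A} K := Set.disjoint_left.2 fun x hx hx' => by
    have h1 : x ∈ A := hx
    exact h.notMem x (by simp [h1]) hx'
  have hBK : Disjoint {x | x ∈ B} K := Set.disjoint_left.2 fun x hx hx' => by
    have h1 : x ∈ B := hx
    exact h.notMem x (by simp [h1]) hx'
  refine ⟨a, b, ![{x | x ∈ A}, {x | x ∈ B}, K], by grind, ?_, ?_, ?_⟩
  · intro i
    fin_cases i
    exacts [hint hch.1, hint hch.2, h.connected]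
  · intro i j hij
    fin_cases i <;> fin_cases j
    exacts [(hij rfl).elim, hAB, hAK, hAB.symm, (hij rfl).elim, hBK, hAK.symm, hBK.symm,
      (hij rfl).elim]
  · intro i
    fin_cases i
    · exact ⟨fun h : a ∈ A => by grind, fun h : b ∈ A => by grind, hAadj.1, hAadj.2⟩
    · exact ⟨fun h : a ∈ B => by grind, fun h : b ∈ B => by grind, hBadj.2, hBadj.1⟩
    · exact ⟨h.notMem a (by simp), h.notMem b (by simp), ha, hb⟩

/-- A separated pair with a largest connected set. -/
structure MaxSeparated (G : SimpleGraph V) (K : Set V) (C : List V) : Prop where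
  separated : Separated G K C
  max : ∀ K' C', Separated G K' C' → K'.ncard ≤ K.ncard

theorem MaxSeparated.of_perm {K : Set V} {C C' : List V} (h : MaxSeparated G K C)
    (hC' : IsCycleList G C') (hp : C'.Perm C) : MaxSeparated G K C' :=
  ⟨h.separated.of_perm hC' hp, h.max⟩

theorem MaxSeparated.rotate {K : Set V} {A B : List V} (h : MaxSeparated G K (A ++ B)) :
    MaxSeparated G K (B ++ A) :=
  ⟨h.separated.rotate, h.max⟩

theorem isCycleList_of_isChain {q y : V} {P : List V} (h : (q :: (P ++ [y])).IsChain G.Adj)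
    (hn : (q :: (P ++ [y])).Nodup) (hqy : G.Adj q y) (hP : P ≠ []) :
    IsCycleList G (q :: (P ++ [y])) := by
  refine ⟨hn, ?_, chain_iff_of_split.2 ⟨h, by simpa using hqy.symm⟩⟩
  have := List.length_pos_iff.2 hP
  simp
  omega

variable [Finite V]

theorem MaxSeparated.false_of_ssubset {K K' : Set V} {C C' : List V} (h : MaxSeparated G K C)
    (h' : Separated G K' C') (hsub : K ⊆ K') {x : V} (hx : x ∈ K') (hxK : x ∉ K) : False :=
  (h.max K' C' h').not_gt (Set.ncard_lt_ncard (Set.ssubset_iff_of_subset hsub |>.2 ⟨x, hx, hxK⟩))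

/-- Rerouting moves the nonempty arc `B` from the cycle into the connected set. -/
theorem MaxSeparated.false_of_reroute {K : Set V} {a b : V} {A B Q : List V}
    (h : MaxSeparated G K (a :: (A ++ b :: B))) (hQ : (b :: (Q ++ [a])).IsChain G.Adj)
    (hQn : Q.Nodup) (hQK : ∀ q ∈ Q, q ∉ K) (hQC : ∀ q ∈ Q, q ∉ a :: (A ++ b :: B))
    (hatt : ∀ c, Attached G K c → c ∈ a :: (A ++ b :: B) → c ∈ B) (hB : B ≠ [])
    (hAQ : A ≠ [] ∨ Q ≠ []) : False := by
  obtain ⟨x, hx⟩ := List.exists_mem_of_ne_nil B hB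
  exact h.false_of_ssubset (h.separated.reroute hQ hQn hQK hQC hatt hB hAQ)
    Set.subset_union_left (.inr hx) (h.separated.notMem x (by simp [hx]))

/-- In a maximal separated pair, the cycle has no ear with unattached ends. -/
theorem MaxSeparated.false_of_ear {K : Set V} {a b : V} {A B Q : List V}
    (h : MaxSeparated G K (a :: (A ++ b :: B))) (hθ : ¬ HasThetaMinor G)
    (hQ : (b :: (Q ++ [a])).IsChain G.Adj)
    (hQn : Q.Nodup) (hQK : ∀ q ∈ Q, q ∉ K) (hQC : ∀ q ∈ Q, q ∉ a :: (A ++ b :: B))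
    (ha : ¬ Attached G K a) (hb : ¬ Attached G K b)
    (hAQ : A ≠ [] ∨ Q ≠ []) (hBQ : B ≠ [] ∨ Q ≠ []) : False := by
  have h' : MaxSeparated G K (b :: (B ++ a :: A)) := by
    have := h
    rw [← List.cons_append] at this
    simpa using this.rotate
  have hlen := h.separated.cycle.three_le
  -- Attached vertices inside both arcs yield a theta minor. Otherwise an arc without attached
  -- vertices forms a new cycle with the ear, and `K` absorbs the other arc.
  by_cases hcA : ∃ c ∈ A, Attached G K c
  · by_cases hcB : ∃ c ∈ B, Attached G K c
    · obtain ⟨c, hc, hcK⟩ := hcA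
      obtain ⟨d, hd, hdK⟩ := hcB
      obtain ⟨A₁, A₂, rfl⟩ := List.append_of_mem hc
      obtain ⟨B₁, B₂, rfl⟩ := List.append_of_mem hd
      have h2 : MaxSeparated G K
          ((a :: A₁) ++ (c :: ((A₂ ++ b :: B₁) ++ d :: B₂))) := by simpa using h
      have h3 : MaxSeparated G K (c :: ((A₂ ++ b :: B₁) ++ d :: (B₂ ++ a :: A₁))) := by
        simpa using h2.rotate
      exact hθ (h3.separated.hasThetaMinor (by simp) (by simp) hcK hdK)
    · obtain ⟨c, hc, hcK⟩ := hcA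
      refine h'.false_of_reroute (Q := Q.reverse) ?_ (by simpa using hQn) (by simpa using hQK)
        ?_ ?_ (List.ne_nil_of_mem hc) (by simpa using hBQ)
      · simpa using isChain_reverse_of_isChain hQ
      · intro q hq hq'
        exact hQC q (by simpa using hq) (by grind)
      · intro d hd hd'
        by_contra hdA
        have : d = b ∨ d ∈ B ∨ d = a := by grind
        rcases this with rfl | h4 | rfl
        exacts [hb hd, hcB ⟨d, h4, hd⟩, ha hd]
  · by_cases hB : B = []
    · subst hB
      have hA : A ≠ [] := by rintro rfl; simp at hlen
      refine h'.false_of_reroute (Q := Q.reverse) ?_ (by simpa using hQn) (by simpa using hQK)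
        ?_ ?_ hA (by simpa using hBQ)
      · simpa using isChain_reverse_of_isChain hQ
      · intro q hq hq'
        exact hQC q (by simpa using hq) (by grind)
      · intro d hd hd'
        by_contra hdA
        have : d = b ∨ d = a := by grind
        rcases this with rfl | rfl
        exacts [hb hd, ha hd]
    · refine h.false_of_reroute hQ hQn hQK hQC ?_ hB hAQ
      intro d hd hd'
      by_contra hdB
      have : d = a ∨ d ∈ A ∨ d = b := by grind
      rcases this with rfl | h4 | rfl
      exacts [ha hd, hcA ⟨d, h4, hd⟩, hb hd]

/-- A path that starts at `c` and then avoids `T` can be continued until its end `q` has a further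
neighbor in `T` or on the path. -/
theorem exists_maximal_path (hmin : ∀ v w, G.Adj v w → ∃ w', w' ≠ w ∧ G.Adj v w') (T : Set V)
    {c z : V} (hz : z ∉ T) (hzc : G.Adj z c) :
    ∃ q P y, (q :: (P ++ [c])).IsChain G.Adj ∧ (q :: P).Nodup ∧ (∀ x ∈ q :: P, x ∉ T) ∧
      G.Adj q y ∧ (P ++ [c]).head? ≠ some y ∧ (y ∈ T ∨ y ∈ P) := by
  have := Fintype.ofFinite V
  -- Otherwise the path could be prolonged at `q` forever, against finiteness.
  by_contra! hcon
  have hlong : ∀ n : ℕ, ∃ q P, (q :: (P ++ [c])).IsChain G.Adj ∧ (q :: P).Nodup ∧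
      (∀ x ∈ q :: P, x ∉ T) ∧ n ≤ P.length := by
    intro n
    induction n with
    | zero => exact ⟨z, [], by simpa using hzc, by simp, by simpa using hz, le_rfl⟩
    | succ n ih =>
      obtain ⟨q, P, h1, h2, h3, h4⟩ := ih
      obtain ⟨p, hp⟩ : ∃ p, (P ++ [c]).head? = some p := by cases P <;> simp
      have hqp : G.Adj q p := by
        cases P with
        | nil =>
          obtain rfl : c = p := by simpa using hp
          simpa using h1
        | cons x P =>
          obtain rfl : x = p := by simpa using hp
          exact (List.isChain_cons_cons.1 h1).1
      obtain ⟨y, hyp, hqy⟩ := hmin q p hqp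
      have hy := hcon q P y h1 h2 h3 hqy (by rw [hp]; simpa using hyp.symm)
      refine ⟨y, q :: P, List.isChain_cons_cons.2 ⟨hqy.symm, h1⟩, ?_, ?_, by simpa using h4⟩
      · refine List.nodup_cons.2 ⟨?_, h2⟩
        rw [List.mem_cons, not_or]
        exact ⟨hqy.ne', hy.2⟩
      · intro x hx
        rcases List.mem_cons.1 hx with rfl | hx
        exacts [hy.1, h3 x hx]
  obtain ⟨q, P, -, h2, -, h4⟩ := hlong (Fintype.card V)
  have := h2.length_le_card
  simp at this
  omega

/-- With `T = {u}`, the further neighbor of the end of a maximal path closes a cycle, either at `u`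
or at an inner vertex of the path. -/
theorem exists_isCycleList (hmin : ∀ v w, G.Adj v w → ∃ w', w' ≠ w ∧ G.Adj v w') {u v : V}
    (huv : G.Adj u v) : ∃ C, IsCycleList G C := by
  obtain ⟨q, P, y, h1, h2, h3, hqy, hhead, hy⟩ :=
    exists_maximal_path hmin {u} (z := v) (c := u) huv.ne' huv.symm
  rcases hy with rfl | hy
  · refine ⟨_, isCycleList_of_isChain h1 ?_ hqy ?_⟩
    · have := h3 y
      grind
    · rintro rfl
      simp at hhead
  · obtain ⟨P₁, P₂, rfl⟩ := List.append_of_mem hy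
    have h1' : (q :: (P₁ ++ y :: (P₂ ++ [u]))).IsChain G.Adj := by simpa using h1
    refine ⟨_, isCycleList_of_isChain (List.isChain_cons_split.1 h1').1 ?_ hqy ?_⟩
    · grind
    · rintro rfl
      simp at hhead

theorem exists_maxSeparated {C : List V} (hC : IsCycleList G C) : ∃ K C, MaxSeparated G K C := by
  have h0 : Separated G ∅ C := by
    refine ⟨fun u hu => hu.elim, hC, by simp, by simp⟩
  by_contra! hcon
  have hlarge : ∀ n : ℕ, ∃ K C, Separated G K C ∧ n ≤ K.ncard := by
    intro n
    induction n with
    | zero => exact ⟨∅, C, h0, Nat.zero_le _⟩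
    | succ n ih =>
      obtain ⟨K, C, h, hn⟩ := ih
      by_contra! hmax
      exact hcon K C ⟨h, fun K' C' h' => by have := hmax K' C' h'; omega⟩
  obtain ⟨K, C, -, hK⟩ := hlarge (Nat.card V + 1)
  have := Set.ncard_le_card K
  omega

end Cycles

theorem card_edgeSet_deleteIncidenceSet_lt {V : Type*} [Finite V] {G : SimpleGraph V} {x y : V} (hxy : G.Adj x y) :
    (G.deleteIncidenceSet x).edgeSet.ncard < G.edgeSet.ncard := by
  refine Set.ncard_lt_ncard (Set.ssubset_iff_of_subset
    (edgeSet_deleteIncidenceSet_subset x) |>.2 ⟨s(x, y), hxy, ?_⟩) (Set.toFinite _)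
  exact fun h => (mem_edgeSet_deleteIncidenceSet.1 h).2.1 rfl

/-! ### Unavoidable configurations -/

section Structure

variable {V : Type*} {G : SimpleGraph V} [Fintype V] [DecidableRel G.Adj]

theorem false_of_four_neighbors (hdeg : ∀ v, G.degree v ≤ 3) {v a b c d : V} (ha : G.Adj v a)
    (hb : G.Adj v b) (hc : G.Adj v c) (hd : G.Adj v d) (hab : a ≠ b) (hac : a ≠ c) (had : a ≠ d)
    (hbc : b ≠ c) (hbd : b ≠ d) (hcd : c ≠ d) : False := by
  classical
  have hsub : ({a, b, c, d} : Finset V) ⊆ G.neighborFinset v := by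
    intro z
    simp only [Finset.mem_insert, Finset.mem_singleton, SimpleGraph.mem_neighborFinset]
    rintro (rfl | rfl | rfl | rfl) <;> assumption
  have h4 : ({a, b, c, d} : Finset V).card = 4 := by
    rw [Finset.card_insert_of_notMem, Finset.card_insert_of_notMem, Finset.card_pair hcd] <;>
      simp [*]
  have := Finset.card_le_card hsub
  rw [h4, G.card_neighborFinset_eq_degree] at this
  have := hdeg v
  omega

/-- Neighbors of unattached vertices of the cycle in a maximal separated pair. -/
theorem MaxSeparated.eq_or_eq_of_adj (hdeg : ∀ v, G.degree v ≤ 3)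
    (hmin : ∀ v w, G.Adj v w → ∃ w', w' ≠ w ∧ G.Adj v w') (hθ : ¬ HasThetaMinor G)
    {K : Set V} {c x y : V} {M : List V} (h : MaxSeparated G K (c :: x :: (M ++ [y])))
    (hc : ¬ Attached G K c) {z : V} (hcz : G.Adj c z) : z = x ∨ z = y := by
  by_contra! hz
  obtain ⟨hzx, hzy⟩ := hz
  have hcyc := h.separated.cycle
  have hnd := hcyc.nodup
  obtain ⟨hcx, hcy⟩ := hcyc.adj_of_split
  have hxy : x ≠ y := by grind
  -- Two neighbors on the cycle and one outside both the cycle and `K` exhaust the degree.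
  have hunatt : ∀ b ∈ c :: x :: (M ++ [y]), ∀ q, q ∉ c :: x :: (M ++ [y]) → q ∉ K → G.Adj b q →
      ¬ Attached G K b := by
    rintro b hb q hqC hqK hbq ⟨k, hk, hbk⟩
    obtain ⟨x', y', M', hC', hp⟩ := hcyc.exists_rotate hb
    obtain ⟨h1, h2⟩ := hC'.adj_of_split
    have hx' : x' ∈ c :: x :: (M ++ [y]) := hp.mem_iff.1 (by simp)
    have hy' : y' ∈ c :: x :: (M ++ [y]) := hp.mem_iff.1 (by simp)
    refine false_of_four_neighbors hdeg h1 h2 hbq hbk ?_ ?_ ?_ ?_ ?_ ?_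
    · have := hC'.nodup
      grind
    · rintro rfl; exact hqC hx'
    · rintro rfl; exact h.separated.notMem _ hx' hk
    · rintro rfl; exact hqC hy'
    · rintro rfl; exact h.separated.notMem _ hy' hk
    · rintro rfl; exact hqK hk
  by_cases hzK : z ∈ K
  · exact hc ⟨z, hzK, hcz⟩
  by_cases hzC : z ∈ c :: x :: (M ++ [y])
  -- A chord is an ear without interior vertices; its other end is unattached by its degree.
  · have hzM : z ∈ M := by
      have := hcz.ne'
      grind
    obtain ⟨M₁, M₂, rfl⟩ := List.append_of_mem hzM
    have h' : MaxSeparated G K (c :: ((x :: M₁) ++ z :: (M₂ ++ [y]))) := by simpa using h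
    have hch := chain_iff_of_split.1 h'.separated.cycle.chain
    refine h'.false_of_ear hθ (Q := []) (by simpa using hcz.symm) (by simp) (by simp) (by simp)
      hc ?_ (by simp) (by simp)
    rintro ⟨k, hk, hzk⟩
    obtain ⟨p, hp, hzp⟩ := (exists_adj_of_isChain hch.1 (by simp)).2
    obtain ⟨r, hr, hzr⟩ := (exists_adj_of_isChain hch.2 (by simp)).1
    have hnotK := h'.separated.notMem
    refine false_of_four_neighbors hdeg hzp hzr hcz.symm hzk ?_ ?_ ?_ ?_ ?_ ?_
    · grind
    · grind
    · rintro rfl; exact hnotK p (by grind) hk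
    · grind
    · rintro rfl; exact hnotK r (by grind) hk
    · rintro rfl; exact hnotK c (by simp) hk
  obtain ⟨q, P, w, h1, h2, h3, hqw, hhead, hw⟩ := exists_maximal_path hmin
    (K ∪ {v | v ∈ c :: x :: (M ++ [y])}) (z := z) (c := c) (by
      rintro (h | h)
      exacts [hzK h, hzC h]) hcz.symm
  have hPK : ∀ p ∈ q :: P, p ∉ K := fun p hp h => h3 p hp (.inl h)
  have hPC : ∀ p ∈ q :: P, p ∉ c :: x :: (M ++ [y]) := fun p hp h => h3 p hp (.inr h)
  rcases hw with (hwK | hwC) | hwP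
  -- The path ends next to `K`, so `K` can be enlarged by `q`.
  · have hq := hPK q (by simp)
    have hconn : ConnectedSet G (K ∪ {q}) := h.separated.connected.union (T := {q})
      (by rintro u rfl v rfl; exact .refl rfl) hwK rfl hqw.symm
    refine h.false_of_ssubset (K' := K ∪ {q}) (C' := c :: x :: (M ++ [y])) ⟨hconn, hcyc, ?_, ?_⟩
      Set.subset_union_left (.inr rfl) hq
    · rintro v hv (hvK | rfl)
      exacts [h.separated.notMem v hv hvK, hPC _ (by simp) hv]
    · intro _
      obtain ⟨k, hk, d, hd, hkd⟩ := h.separated.attached ⟨w, hwK⟩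
      exact ⟨k, .inl hk, d, hd, hkd⟩
  · have hwC' : w ∈ c :: x :: (M ++ [y]) := hwC
    -- The path returns to the cycle: at `c` this gives a fourth neighbor, elsewhere an ear with
    -- unattached ends.
    rcases eq_or_ne w c with rfl | hwc
    · have hP : P ≠ [] := by
        rintro rfl
        simp at hhead
      obtain ⟨p, hp, hwp⟩ := (exists_adj_of_isChain h1 hP).2
      have hpC := hPC p (by simp [hp])
      have hqC := hPC q (by simp)
      refine false_of_four_neighbors hdeg hcx hcy hqw.symm hwp hxy ?_ ?_ ?_ ?_ ?_
      · rintro rfl; simp at hqC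
      · rintro rfl; simp at hpC
      · rintro rfl; simp at hqC
      · rintro rfl; simp at hpC
      · rintro rfl; exact (List.nodup_cons.1 h2).1 hp
    · obtain ⟨R₁, R₂, hR⟩ := List.append_of_mem (List.mem_of_ne_of_mem hwc hwC')
      have hwatt := hunatt w hwC' q (hPC q (by simp)) (hPK q (by simp)) hqw.symm
      rw [hR] at h hPC
      refine h.false_of_ear hθ (Q := q :: P) ?_ h2 hPK hPC hc hwatt (by simp) (by simp)
      exact List.isChain_cons_cons.2 ⟨hqw.symm, h1⟩
  -- The path closes a new cycle. The union of `K`, the old cycle and the part `P₂` of the path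
  -- between them is connected and adjacent to this cycle, so it is a larger choice of `K`.
  · obtain ⟨P₁, P₂, rfl⟩ := List.append_of_mem hwP
    have h1' : (q :: (P₁ ++ w :: (P₂ ++ [c]))).IsChain G.Adj := by simpa using h1
    obtain ⟨h4, h5⟩ := List.isChain_cons_split.1 h1'
    have hcyc' : IsCycleList G (q :: (P₁ ++ [w])) := by
      refine isCycleList_of_isChain h4 ?_ hqw ?_
      · grind
      · rintro rfl
        simp at hhead
    have hconn : ConnectedSet G ((K ∪ {v | v ∈ c :: x :: (M ++ [y])}) ∪ {v | v ∈ P₂ ++ [c]}) := by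
      refine h.separated.connected_union.union_of_mem (x := c) ?_ (.inr ?_) (by simp)
      · rw [← List.singleton_append] at h5
        exact connectedSet_of_isChain h5.right_of_append
      · simp
    refine h.false_of_ssubset ⟨hconn, hcyc', ?_, ?_⟩
      (fun v hv => .inl (.inl hv)) (x := c) (.inl (.inr (by simp)))
      (h.separated.notMem c (by simp))
    · rintro v hv ((hvK | hvC) | hvP)
      · exact hPK v (by grind) hvK
      · exact hPC v (by grind) hvC
      · have hvP' : v ∈ P₂ ++ [c] := hvP
        have := hPC v (by grind)
        grind
    · intro _
      cases P₂ with
      | nil =>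
        have hwc : G.Adj w c := by simpa using h5
        exact ⟨c, .inl (.inr (by simp)), w, by simp, hwc.symm⟩
      | cons p P₂ =>
        exact ⟨p, .inr (by simp), w, by simp, (List.isChain_cons_cons.1 h5).1.symm⟩

theorem MaxSeparated.degree_le_two (hdeg : ∀ v, G.degree v ≤ 3)
    (hmin : ∀ v w, G.Adj v w → ∃ w', w' ≠ w ∧ G.Adj v w') (hθ : ¬ HasThetaMinor G)
    {K : Set V} {C : List V} (h : MaxSeparated G K C) {c : V} (hcC : c ∈ C)
    (hc : ¬ Attached G K c) : G.degree c ≤ 2 := by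
  classical
  obtain ⟨x, y, M, hC', hp⟩ := h.separated.cycle.exists_rotate hcC
  have h' := h.of_perm hC' hp
  rw [← G.card_neighborFinset_eq_degree]
  refine (Finset.card_le_card (t := {x, y}) fun z hz => ?_).trans Finset.card_le_two
  simpa using h'.eq_or_eq_of_adj hdeg hmin hθ hc (by simpa using hz)

/-- A nonempty subcubic graph without theta minors and tetrahedral minors has a vertex of degree
one, two adjacent vertices of degree two, or a triangle with a vertex of degree two. -/
theorem false_of_irreducible (hdeg : ∀ v, G.degree v ≤ 3)
    (hmin : ∀ v w, G.Adj v w → ∃ w', w' ≠ w ∧ G.Adj v w') (hθ : ¬ HasThetaMinor G)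
    (hτ : ¬ HasTetrahedralMinor G)
    (hadj : ∀ x y, G.Adj x y → G.degree x ≤ 2 → ¬ G.degree y ≤ 2)
    (htri : ∀ u v w, G.Adj u v → G.Adj w u → G.Adj w v → ¬ G.degree w ≤ 2)
    {u v : V} (huv : G.Adj u v) : False := by
  obtain ⟨C₀, hC₀⟩ := exists_isCycleList hmin huv
  obtain ⟨K, C, h⟩ := exists_maxSeparated hC₀
  have htwo : ∀ c ∈ C, ¬ Attached G K c → G.degree c ≤ 2 := fun c hc hcK =>
    h.degree_le_two hdeg hmin hθ hc hcK
  by_cases hatt : ∃ c ∈ C, Attached G K c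
  swap
  · push Not at hatt
    obtain ⟨c, hc⟩ : ∃ c, c ∈ C := by
      have := h.separated.cycle.three_le
      exact List.exists_mem_of_length_pos (by omega)
    obtain ⟨x, y, M, hC', hp⟩ := h.separated.cycle.exists_rotate hc
    have hx : x ∈ C := hp.mem_iff.1 (by simp)
    exact hadj c x hC'.adj_of_split.1 (htwo c hc (hatt c hc)) (htwo x hx (hatt x hx))
  obtain ⟨c, hc, hcK⟩ := hatt
  obtain ⟨x, y, M, hC', hp⟩ := h.separated.cycle.exists_rotate hc
  have h' := h.of_perm hC' hp
  have hmem : ∀ {z}, z ∈ c :: x :: (M ++ [y]) → z ∈ C := fun hz => hp.mem_iff.1 hz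
  obtain ⟨hcx, hcy⟩ := hC'.adj_of_split
  have hch := (chain_iff_of_split (A := []) (b := x) (B := M ++ [y])).1 hC'.chain
  cases M with
  | nil =>
    have hxy : G.Adj x y := (List.isChain_cons_cons.1 hch.2).1
    by_cases hx : Attached G K x
    · by_cases hy : Attached G K y
      · refine hτ ⟨![c, x, y], K, ?_, h.separated.connected, ?_⟩
        · intro i j hij
          fin_cases i <;> fin_cases j
          exacts [(hij rfl).elim, hcx, hcy, hcx.symm, (hij rfl).elim, hxy, hcy.symm, hxy.symm,
            (hij rfl).elim]
        · intro i
          fin_cases i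
          exacts [⟨h'.separated.notMem c (by simp), hcK⟩, ⟨h'.separated.notMem x (by simp), hx⟩,
            ⟨h'.separated.notMem y (by simp), hy⟩]
      · exact htri c x y hcx hcy.symm hxy.symm (htwo y (hmem (by simp)) hy)
    · by_cases hy : Attached G K y
      · exact htri c y x hcy hcx.symm hxy (htwo x (hmem (by simp)) hx)
      · exact hadj x y hxy (htwo x (hmem (by simp)) hx) (htwo y (hmem (by simp)) hy)
  | cons m M =>
    have hxm : G.Adj x m := (List.isChain_cons_cons.1 hch.2).1
    -- On a cycle of length at least four, `c` and `m` are not consecutive, so both being attached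
    -- would give a theta minor.
    have hm : ¬ Attached G K m := fun hm =>
      hθ (h'.separated.hasThetaMinor (A := [x]) (B := M ++ [y]) (by simp) (by simp) hcK hm)
    have hm2 := htwo m (hmem (by simp)) hm
    by_cases hx : Attached G K x
    · have h2 : MaxSeparated G K (x :: m :: (M ++ [y] ++ [c])) := by
        have : MaxSeparated G K ([c] ++ x :: m :: (M ++ [y])) := by simpa using h'
        simpa using this.rotate
      obtain ⟨r, R, hR⟩ : ∃ r R, M ++ [y] = r :: R := by cases M <;> simp
      rw [hR] at h2
      have hmr : G.Adj m r := by
        have := chain_iff_of_split (A := []) (b := m) (B := r :: R ++ [c]) |>.1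
          h2.separated.cycle.chain
        exact (List.isChain_cons_cons.1 this.2).1
      -- Likewise `x` and `r` are separated by `m` on one side and by `c` on the other, which leaves
      -- the adjacent vertices `m` and `r` unattached.
      have hr : ¬ Attached G K r := fun hr =>
        hθ (h2.separated.hasThetaMinor (A := [m]) (B := R ++ [c]) (by simp) (by simp) hx hr)
      refine hadj m r hmr hm2 (htwo r (hmem ?_) hr)
      have : r ∈ M ++ [y] := hR ▸ by simp
      simp only [List.cons_append, List.mem_cons, this, or_true]
    · exact hadj x m hxm (htwo x (hmem (by simp)) hx) hm2

theorem exists_two_neighbors (hmin : ∀ v w, G.Adj v w → ∃ w', w' ≠ w ∧ G.Adj v w') {x y : V}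
    (hxy : G.Adj x y) (hx : G.degree x ≤ 2) :
    ∃ z, G.Adj x z ∧ y ≠ z ∧ ∀ w, G.Adj x w → w = y ∨ w = z := by
  classical
  obtain ⟨z, hzy, hxz⟩ := hmin x y hxy
  refine ⟨z, hxz, hzy.symm, fun w hw => ?_⟩
  have hsub : ({y, z} : Finset V) ⊆ G.neighborFinset x := by
    intro v
    simp only [Finset.mem_insert, Finset.mem_singleton, SimpleGraph.mem_neighborFinset]
    rintro (rfl | rfl) <;> assumption
  have heq := Finset.eq_of_subset_of_card_le hsub
    (by rw [Finset.card_pair hzy.symm, G.card_neighborFinset_eq_degree]; exact hx)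
  simpa [← heq] using (G.mem_neighborFinset x w).2 hw

end Structure

/-- A subcubic graph without theta minors and tetrahedral minors has a pair coloring. -/
theorem pairColorable_of_no_minor {V : Type*} [Fintype V] (n : ℕ) : ∀ (G : SimpleGraph V) [DecidableRel G.Adj],
    (∀ v, G.degree v ≤ 3) → ¬ HasThetaMinor G → ¬ HasTetrahedralMinor G →
    G.edgeSet.ncard ≤ n → PairColorable G := by
  classical
  induction n with
  | zero =>
    intro G _ _ _ _ hn
    have hE : G.edgeSet = ∅ := (Set.ncard_eq_zero (Set.toFinite _)).1 (by omega)
    exact ⟨fun _ => ∅, by simp [hE], by simp [hE], by simp [hE]⟩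
  | succ n ih =>
    intro G _ hdeg hθ hτ hn
    -- The degree bound and the absence of both minors pass to subgraphs, so a graph without a pair
    -- coloring contains none of the reducible configurations.
    have hdel : ∀ {x y}, G.Adj x y → PairColorable (G.deleteIncidenceSet x) := by
      intro x y hxy
      have hle := G.deleteIncidenceSet_le x
      refine ih _ (fun v => (SimpleGraph.degree_le_of_le hle).trans (hdeg v))
        (fun h => hθ (h.mono hle)) (fun h => hτ (h.mono hle)) ?_
      have := card_edgeSet_deleteIncidenceSet_lt hxy
      omega
    by_contra hcon
    have hmin : ∀ v w, G.Adj v w → ∃ w', w' ≠ w ∧ G.Adj v w' := by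
      intro v w hvw
      by_contra! h
      exact hcon (.of_degree_eq_one hdeg hvw (fun z hz => by
        by_contra hne
        exact h z hne hz) (hdel hvw))
    have hne : ∃ u v, G.Adj u v := by
      by_contra! h
      have hE : G.edgeSet = ∅ := by
        ext ⟨p, q⟩
        simpa using h p q
      exact hcon ⟨fun _ => ∅, by simp [hE], by simp [hE], by simp [hE]⟩
    obtain ⟨u, v, huv⟩ := hne
    refine false_of_irreducible hdeg hmin hθ hτ ?_ ?_ huv
    · intro x y hxy hx hy
      obtain ⟨z, hxz, hyz, hz⟩ := exists_two_neighbors hmin hxy hx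
      exact hcon (.of_adj_degree_le_two hdeg hxy hxz hyz hz hy (hdel hxy))
    · intro u v w huv hwu hwv hw
      obtain ⟨z, hwz, hvz, hz⟩ := exists_two_neighbors hmin hwv hw
      obtain rfl : u = z := (hz u hwu).resolve_left huv.ne
      exact hcon (.of_triangle hdeg huv hwu hwv hz (hdel hwu))

end ToneEdge

theorem theorem7 {V : Type*} [Fintype V] (G : SimpleGraph V) [DecidableRel G.Adj]
    (hsubcubic : G.maxDegree ≤ 3) (houter : ToneEdge.IsOuterplanar G) :
    ToneEdge.ToneEdgeColorable G 2 8 ∧ ToneEdge.toneChromaticIndex G 2 ≤ 8 := by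
  obtain ⟨f, hf⟩ := ToneEdge.pairColorable_of_no_minor _ G
    (fun v => (G.degree_le_maxDegree v).trans hsubcubic) houter.not_hasThetaMinor
    houter.not_hasTetrahedralMinor le_rfl
  exact ⟨hf.toneEdgeColorable, ToneEdge.toneChromaticIndex_le hf.toneEdgeColorable⟩
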